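/- Let $BS(1,2)=\langle a,b \mid ab=ba^2\rangle$ be the Baumslag–Solitar group, and let $BS^+(1,2)=\{b^m a^x : m,x\in\mathbb Z,\ m\ge 0\}$, which is a submonoid of $BS(1,2)$. Let $S$ be a finite subset of $BS^+(1,2)$ of size $|S|=k$ which is non-abelian, i.e. the subgroup of $BS(1,2)$ generated by $S$ is non-abelian. Put $S^2=\{st : s,t\in S\}$. Then $$|S^2|\ge 3k-2.$$ Moreover, if $h$ is the integer with $|S^2|=(3k-2)+h$ and $$|S^2|=(3k-2)+h<3.5k-4,$$ then there exists a finite set of integers $A\subseteq\mathbb Z$ such that (a) $S=ba^A=\{ba^x : x\in A\}$, and (b) $A$ is contained in an arithmetic progression $\{u,u+d,\dots,u+(l-1)d\}$ of integers, with difference $d>0$ and size $l=k+h<1.5k-2$. -/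

import Mathlib

open scoped Pointwise

/-- The one-element set of relators `b⁻¹ a ^ m b a ^ (-n)` in the free group on the letters
`a = of 0` and `b = of 1`. -/
def baumslagSolitarRels (m n : ℤ) : Set (FreeGroup (Fin 2)) :=
  {(FreeGroup.of 1)⁻¹ * FreeGroup.of 0 ^ m * FreeGroup.of 1 * (FreeGroup.of 0 ^ n)⁻¹}

/-- The Baumslag-Solitar group `BS(m, n) = ⟨a, b ∣ b⁻¹ a ^ m b = a ^ n⟩`
(equivalently `a ^ m b = b a ^ n`). -/
def BaumslagSolitar (m n : ℤ) : Type := PresentedGroup (baumslagSolitarRels m n)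

namespace BaumslagSolitar

instance instGroup (m n : ℤ) : Group (BaumslagSolitar m n) :=
  inferInstanceAs (Group (PresentedGroup (baumslagSolitarRels m n)))

/-- The generator `a` of `BS(m, n)`. -/
def a (m n : ℤ) : BaumslagSolitar m n := PresentedGroup.of (rels := baumslagSolitarRels m n) 0

/-- The generator `b` of `BS(m, n)`. -/
def b (m n : ℤ) : BaumslagSolitar m n := PresentedGroup.of (rels := baumslagSolitarRels m n) 1

theorem inv_b_mul_a_zpow_mul_b (m n : ℤ) : (b m n)⁻¹ * a m n ^ m * b m n = a m n ^ n := by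
  rw [← mul_inv_eq_one]
  exact PresentedGroup.one_of_mem (rels := baumslagSolitarRels m n) (Set.mem_singleton _)

theorem a_zpow_mul_b (x : ℤ) : a 1 2 ^ x * b 1 2 = b 1 2 * a 1 2 ^ (2 * x) := by
  have h : (b 1 2)⁻¹ * a 1 2 * b 1 2 = a 1 2 ^ (2 : ℤ) := by
    simpa using inv_b_mul_a_zpow_mul_b 1 2
  have h2 : (b 1 2)⁻¹ * a 1 2 ^ x * b 1 2 = a 1 2 ^ (2 * x) := by
    rw [zpow_mul, ← h]
    simpa using (conj_zpow (i := x) (a := (b 1 2)⁻¹) (b := a 1 2)).symm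
  rw [← h2]
  group

theorem a_zpow_mul_b_pow (x : ℤ) (t : ℕ) :
    a 1 2 ^ x * b 1 2 ^ t = b 1 2 ^ t * a 1 2 ^ (2 ^ t * x) := by
  induction t generalizing x with
  | zero => simp
  | succ t ih =>
    rw [pow_succ, ← mul_assoc, ih, mul_assoc, a_zpow_mul_b, mul_assoc, ← mul_assoc 2, ← pow_succ']

/-- The monoid `BS⁺(1, 2) = {b ^ m a ^ x : m, x ∈ ℤ, m ≥ 0}` inside the group `BS(1, 2)`. -/
def plus : Submonoid (BaumslagSolitar 1 2) where
  carrier := {g | ∃ (m : ℕ) (x : ℤ), g = b 1 2 ^ m * a 1 2 ^ x}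
  one_mem' := ⟨0, 0, by simp⟩
  mul_mem' := by
    rintro _ _ ⟨r, x, rfl⟩ ⟨s, y, rfl⟩
    refine ⟨r + s, 2 ^ s * x + y, ?_⟩
    rw [pow_add, zpow_add, mul_assoc, ← mul_assoc (a 1 2 ^ x), a_zpow_mul_b_pow]
    simp only [mul_assoc]

end BaumslagSolitar

/-- A subset of a group is non-abelian if the subgroup that it generates is not commutative. -/
def IsNonabelianSubset {G : Type*} [Group G] (S : Set G) : Prop :=
  ¬ ∀ x ∈ Subgroup.closure S, ∀ y ∈ Subgroup.closure S, x * y = y * x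

/-- A finite arithmetic progression `{u, u + d, …, u + (l - 1) d}` of integers with positive
difference `d`; its size is `l`. -/
def IsFiniteArithProg (P : Finset ℤ) : Prop :=
  ∃ (u d : ℤ) (l : ℕ), 0 < d ∧ P = (Finset.range l).image (fun i : ℕ => u + (i : ℤ) * d)

/-! Write each element of `S` as b^m a^x and call m its level. Since a^x b^n = b^n a^(2^n x), the
product of the slices b^m a^A and b^n a^B is b^(m+n) a^(2^n·A + B). Bounding S² is thus a problem
about sums of dilates of integer sets.

If `S` lies on one level m, then m > 0 because level 0 is abelian, and S² corresponds to r·A + A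
with r = 2^m. Splitting A into residue classes mod r splits r·A + A into translated dilates of A +
F_j, where F_j is the set of quotients of the class j. The Lev–Smeliansky bound for A + F_j, itself
derived from Kneser's theorem modulo the diameter of A, leaves two cases: either |S²| ≥ 4k − 4, or A
lies in a progression of l + 1 terms with l + 2k − 1 ≤ |S²|. For r ≥ 4 the second case forces l ≥ 2k
− 4 as well, so |S²| ≥ 4k − 5. Hence small doubling is possible only for m = 1, and there it gives
the progression.

If `S` meets several levels, then |S²| ≥ 3.5k − 4 (`several_levels_bound`), which rules out small
doubling. The top level is peeled off, and each removal must account for at least 3.5 products per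
removed element. Two special configurations need their own arguments: two levels with the lower one
in ⟨a⟩ (a parity argument), and a commuting set below the top level (commutation is transitive away
from the identity, so centralizers are thin). -/

/-! ### Kneser's theorem for finite abelian groups -/

section Kneser

variable {G : Type*} [AddCommGroup G] [Fintype G] [DecidableEq G]

/-- The subgroup of periods of a finite set `C`, as a finite set. -/
def periods (C : Finset G) : Finset G :=
  Finset.univ.filter fun g => ∀ c, g + c ∈ C ↔ c ∈ C

theorem mem_periods {C : Finset G} {g : G} : g ∈ periods C ↔ ∀ c, g + c ∈ C ↔ c ∈ C := by
  simp [periods]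

theorem zero_mem_periods (C : Finset G) : (0 : G) ∈ periods C := by
  simp [mem_periods]

theorem add_mem_periods {C : Finset G} {g h : G} (hg : g ∈ periods C) (hh : h ∈ periods C) :
    g + h ∈ periods C := by
  rw [mem_periods] at *
  intro c
  rw [add_assoc, hg, hh]

theorem neg_mem_periods {C : Finset G} {g : G} (hg : g ∈ periods C) : -g ∈ periods C := by
  rw [mem_periods] at *
  intro c
  rw [← hg (-g + c), add_neg_cancel_left]

theorem sub_mem_periods {C : Finset G} {g h : G} (hg : g ∈ periods C) (hh : h ∈ periods C) :
    g - h ∈ periods C := by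
  rw [sub_eq_add_neg]
  exact add_mem_periods hg (neg_mem_periods hh)

/-- Translation by `g` is injective, so it maps the finite set `C` onto itself. -/
theorem mem_periods_of_forall {C : Finset G} {g : G} (hg : ∀ c ∈ C, g + c ∈ C) :
    g ∈ periods C := by
  have himg : C.image (fun c => g + c) = C := by
    apply Finset.eq_of_subset_of_card_le
    · intro x hx
      obtain ⟨c, hc, rfl⟩ := Finset.mem_image.1 hx
      exact hg c hc
    · rw [Finset.card_image_of_injective _ (add_right_injective g)]
  rw [mem_periods]
  refine fun c => ⟨fun h => ?_, hg c⟩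
  rw [← himg] at h
  obtain ⟨d, hd, hdc⟩ := Finset.mem_image.1 h
  rwa [← add_left_cancel hdc]

/-- Two pairs with the same sum x + p + q differ by a common period of `C₁` and `C₂`, so the fibres
of the sum map have at most |periods C₁ ∩ periods C₂| elements. -/
theorem card_mul_card_le_of_grid {C₁ C₂ P Q D : Finset G} {x : G} (hP : P ⊆ periods C₁)
    (hQ : Q ⊆ periods C₂) (hD : ∀ p ∈ P, ∀ q ∈ Q, x + p + q ∈ D) :
    P.card * Q.card ≤ (periods C₁ ∩ periods C₂).card * D.card := by
  rw [← Finset.card_product]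
  refine (Finset.card_le_mul_card_image (f := fun z : G × G => x + z.1 + z.2) (P ×ˢ Q)
    (periods C₁ ∩ periods C₂).card ?_).trans ?_
  · intro b hb
    obtain ⟨⟨p, q⟩, hpq, rfl⟩ := Finset.mem_image.1 hb
    rw [Finset.mem_product] at hpq
    refine Finset.card_le_card_of_injOn (fun z => z.1 - p) ?_ ?_
    · intro z hz
      simp only [Finset.coe_filter, Finset.mem_product, Set.mem_ofPred_eq] at hz
      obtain ⟨⟨h1, h2⟩, h3⟩ := hz
      have h4 : z.1 - p = q - z.2 := by
        rw [sub_eq_sub_iff_add_eq_add]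
        have h5 : x + (z.1 + z.2) = x + (p + q) := by simpa only [add_assoc] using h3
        rw [add_left_cancel h5, add_comm]
      simp only [Finset.coe_inter, Set.mem_inter_iff, Finset.mem_coe]
      refine ⟨sub_mem_periods (hP h1) (hP hpq.1), ?_⟩
      rw [h4]
      exact sub_mem_periods (hQ hpq.2) (hQ h2)
    · intro z hz w hw hzw
      simp only [Finset.coe_filter, Finset.mem_product, Set.mem_ofPred_eq] at hz hw
      have h1 : z.1 = w.1 := sub_left_injective hzw
      have h2 := hz.2.trans hw.2.symm
      rw [h1] at h2
      exact Prod.ext h1 (add_left_cancel h2)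
  · refine Nat.mul_le_mul_left _ (Finset.card_le_card ?_)
    intro y hy
    obtain ⟨⟨p, q⟩, hpq, rfl⟩ := Finset.mem_image.1 hy
    rw [Finset.mem_product] at hpq
    exact hD p hpq.1 q hpq.2

theorem card_periods_inter_le_of_nonempty {C₁ C₂ P : Finset G} (hne : P.Nonempty)
    (hP : ∀ p ∈ P, ∀ g ∈ periods C₁ ∩ periods C₂, g + p ∈ P) :
    (periods C₁ ∩ periods C₂).card ≤ P.card := by
  obtain ⟨p, hp⟩ := hne
  exact Finset.card_le_card_of_injOn (fun g => g + p) (fun g hg => hP p hp g hg)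
    (fun _ _ _ _ h => add_left_injective p h)

/-- Inside x + H₁ + H₂, with Hᵢ the periods of `Cᵢ`, membership in `C₁` depends only on the
H₂-coordinate and membership in `C₂` only on the H₁-coordinate. So `C₁ \ C₂` and `C₂ \ C₁` contain
grids, which are too large for the hypotheses unless |H₁| < |H₂|. Applied with the roles exchanged
as well, this yields a contradiction. -/
theorem card_periods_lt_card_periods {C₁ C₂ : Finset G} {x : G} (hx₁ : x ∈ C₁) (hx₂ : x ∉ C₂)
    (h₁ : (C₁ \ C₂).card + (periods C₁ ∩ periods C₂).card < (periods C₂).card)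
    (h₂ : (C₂ \ C₁).card + (periods C₁ ∩ periods C₂).card < (periods C₁).card) :
    (periods C₁).card < (periods C₂).card := by
  set K := periods C₁ ∩ periods C₂ with hK
  set U := (periods C₂).filter (fun h => x + h ∈ C₁) with hU
  set U' := (periods C₂).filter (fun h => ¬ x + h ∈ C₁) with hU'
  set V := (periods C₁).filter (fun h => x + h ∈ C₂) with hV
  set V' := (periods C₁).filter (fun h => ¬ x + h ∈ C₂) with hV'
  have hUU : U.card + U'.card = (periods C₂).card := Finset.card_filter_add_card_filter_not _
  have hVV : V.card + V'.card = (periods C₁).card := Finset.card_filter_add_card_filter_not _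
  have e1 : ∀ p ∈ periods C₁, ∀ q, x + p + q ∈ C₁ ↔ x + q ∈ C₁ := by
    intro p hp q
    rw [← mem_periods.1 hp (x + q)]
    rw [show x + p + q = p + (x + q) by abel]
  have e2 : ∀ p, ∀ q ∈ periods C₂, x + p + q ∈ C₂ ↔ x + p ∈ C₂ := by
    intro p q hq
    rw [← mem_periods.1 hq (x + p)]
    rw [show x + p + q = q + (x + p) by abel]
  have b1 : V'.card * U.card ≤ K.card * (C₁ \ C₂).card := by
    refine card_mul_card_le_of_grid (x := x) (Finset.filter_subset _ _)
      (Finset.filter_subset _ _) ?_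
    intro p hp q hq
    rw [Finset.mem_filter] at hp hq
    rw [Finset.mem_sdiff, e1 p hp.1, e2 p q hq.1]
    exact ⟨hq.2, hp.2⟩
  have b2 : V.card * U'.card ≤ K.card * (C₂ \ C₁).card := by
    refine card_mul_card_le_of_grid (x := x) (Finset.filter_subset _ _)
      (Finset.filter_subset _ _) ?_
    intro p hp q hq
    rw [Finset.mem_filter] at hp hq
    rw [Finset.mem_sdiff, e1 p hp.1, e2 p q hq.1]
    exact ⟨hp.2, hq.2⟩
  have f1 : ∀ g ∈ K, ∀ p, x + (g + p) ∈ C₁ ↔ x + p ∈ C₁ := by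
    intro g hg p
    rw [← add_assoc]
    exact e1 g (Finset.mem_inter.1 hg).1 p
  have f2 : ∀ g ∈ K, ∀ p, x + (g + p) ∈ C₂ ↔ x + p ∈ C₂ := by
    intro g hg p
    rw [add_comm g, ← add_assoc]
    exact e2 p g (Finset.mem_inter.1 hg).2
  have cU : K.card ≤ U.card := by
    refine card_periods_inter_le_of_nonempty
      ⟨0, Finset.mem_filter.2 ⟨zero_mem_periods _, by simpa⟩⟩ ?_
    intro p hp g hg
    rw [Finset.mem_filter] at hp ⊢
    exact ⟨add_mem_periods (Finset.mem_inter.1 hg).2 hp.1, (f1 g hg p).2 hp.2⟩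
  have cV' : K.card ≤ V'.card := by
    refine card_periods_inter_le_of_nonempty
      ⟨0, Finset.mem_filter.2 ⟨zero_mem_periods _, by simpa⟩⟩ ?_
    intro p hp g hg
    rw [Finset.mem_filter] at hp ⊢
    exact ⟨add_mem_periods (Finset.mem_inter.1 hg).1 hp.1, fun h => hp.2 ((f2 g hg p).1 h)⟩
  have cU' : U'.card = 0 ∨ K.card ≤ U'.card := by
    rcases U'.eq_empty_or_nonempty with h | h
    · exact Or.inl (by rw [h]; rfl)
    · refine Or.inr (card_periods_inter_le_of_nonempty h ?_)
      intro p hp g hg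
      rw [Finset.mem_filter] at hp ⊢
      exact ⟨add_mem_periods (Finset.mem_inter.1 hg).2 hp.1, fun h => hp.2 ((f1 g hg p).1 h)⟩
  have cV : V.card = 0 ∨ K.card ≤ V.card := by
    rcases V.eq_empty_or_nonempty with h | h
    · exact Or.inl (by rw [h]; rfl)
    · refine Or.inr (card_periods_inter_le_of_nonempty h ?_)
      intro p hp g hg
      rw [Finset.mem_filter] at hp ⊢
      exact ⟨add_mem_periods (Finset.mem_inter.1 hg).1 hp.1, (f2 g hg p).2 hp.2⟩
  have hq : 0 < K.card := Finset.card_pos.2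
    ⟨0, Finset.mem_inter.2 ⟨zero_mem_periods _, zero_mem_periods _⟩⟩
  clear_value K U U' V V'
  generalize K.card = q at *
  generalize U.card = s at *
  generalize U'.card = y at *
  generalize V.card = z at *
  generalize V'.card = w at *
  generalize (C₁ \ C₂).card = c at *
  generalize (C₂ \ C₁).card = d at *
  rw [← hUU] at h₁ ⊢
  rw [← hVV] at h₂ ⊢
  zify at *
  -- Scaling by `q` lets the grid bounds `b1`, `b2` replace q·c and q·d.
  have h₁' : (q : ℤ) * c + q * q + q ≤ q * (s + y) := by nlinarith
  have h₂' : (q : ℤ) * d + q * q + q ≤ q * (z + w) := by nlinarith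
  -- Only z = 0 is consistent. When z and y are both at least q, adding the two inequalities gives
  -- (w − q)(s − q) + (z − q)(y − q) + 2q ≤ 0.
  rcases cV with hz | hz
  · obtain rfl : z = 0 := by exact_mod_cast hz
    by_contra hcon
    push Not at hcon
    nlinarith
  · rcases cU' with hy | hy
    · obtain rfl : y = 0 := by exact_mod_cast hy
      nlinarith [mul_le_mul_of_nonneg_right cV' (hq.le.trans cU), mul_pos hq hq]
    · nlinarith [mul_nonneg (sub_nonneg.2 cU) (sub_nonneg.2 cV'),
        mul_nonneg (sub_nonneg.2 hz) (sub_nonneg.2 hy)]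

/-- A common period of both sets is a period of the union. If the bound failed for the union, both
differences would be small enough for `card_periods_lt_card_periods` in both directions, making each
period group smaller than the other. -/
theorem le_card_union_add_card_periods {C₁ C₂ : Finset G} {N : ℕ}
    (h₁ : N ≤ C₁.card + (periods C₁).card) (h₂ : N ≤ C₂.card + (periods C₂).card) :
    N ≤ (C₁ ∪ C₂).card + (periods (C₁ ∪ C₂)).card := by
  by_cases s1 : C₁ ⊆ C₂
  · rwa [Finset.union_eq_right.2 s1]
  by_cases s2 : C₂ ⊆ C₁
  · rwa [Finset.union_eq_left.2 s2]
  obtain ⟨x, hx1, hx2⟩ := Finset.not_subset.1 s1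
  obtain ⟨y, hy2, hy1⟩ := Finset.not_subset.1 s2
  by_contra! hcon
  have hK : (periods C₁ ∩ periods C₂).card ≤ (periods (C₁ ∪ C₂)).card := by
    refine Finset.card_le_card fun g hg => ?_
    rw [Finset.mem_inter, mem_periods, mem_periods] at hg
    rw [mem_periods]
    intro c
    rw [Finset.mem_union, Finset.mem_union, hg.1, hg.2]
  have c1 : (C₁ ∪ C₂).card = C₁.card + (C₂ \ C₁).card := by
    rw [add_comm, Finset.card_sdiff_add_card, Finset.union_comm]
  have c2 : (C₁ ∪ C₂).card = C₂.card + (C₁ \ C₂).card := by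
    rw [add_comm, Finset.card_sdiff_add_card]
  have k1 := card_periods_lt_card_periods hx1 hx2 (by omega) (by omega)
  have k2 := card_periods_lt_card_periods hy2 hy1
    (by rw [Finset.inter_comm]; omega) (by rw [Finset.inter_comm]; omega)
  omega

/-- Dyson's transform, by induction on |B|. When no transform changes the pair, B − b consists of
periods of A and A + b serves as `C`. -/
theorem exists_subset_add_le_card_add_card_periods (n : ℕ) {A B : Finset G} (hn : B.card = n)
    {a b : G} (ha : a ∈ A) (hb : b ∈ B) :
    ∃ C ⊆ A + B, a + b ∈ C ∧ A.card + B.card ≤ C.card + (periods C).card := by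
  induction n using Nat.strong_induction_on generalizing A B with
  | _ n ih =>
    by_cases h : ∀ e ∈ A, ∀ c ∈ B, c + (e - b) ∈ A
    · refine ⟨A.image (fun x => x + b), ?_, Finset.mem_image_of_mem _ ha, ?_⟩
      · intro y hy
        obtain ⟨x, hx, rfl⟩ := Finset.mem_image.1 hy
        exact Finset.add_mem_add hx hb
      · rw [Finset.card_image_of_injective _ (add_left_injective b)]
        refine Nat.add_le_add_left ?_ _
        refine Finset.card_le_card_of_injOn (fun c => c - b) ?_
          (fun _ _ _ _ h => sub_left_injective h)
        intro c hc
        refine mem_periods_of_forall fun y hy => ?_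
        obtain ⟨x, hx, rfl⟩ := Finset.mem_image.1 hy
        refine Finset.mem_image.2 ⟨c + (x - b), h x hx c hc, ?_⟩
        change c + (x - b) + b = c - b + (x + b)
        abel
    · push Not at h
      obtain ⟨e, he, c, hc, hce⟩ := h
      -- The elements of `B` whose shift by e − b falls outside `A` are moved over to `A`. This
      -- keeps the total size, keeps `b` (its shift is `e`), and removes `c`, so `B` shrinks.
      set B' := B.filter (fun y => y + (e - b) ∈ A) with hB'
      set B'' := B.filter (fun y => ¬ y + (e - b) ∈ A) with hB''
      set E := B''.image (fun y => y + (e - b)) with hE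
      have hbB' : b ∈ B' := Finset.mem_filter.2 ⟨hb, by simpa⟩
      have hcard : B'.card + B''.card = B.card := Finset.card_filter_add_card_filter_not _
      have hpos : 0 < B''.card := Finset.card_pos.2 ⟨c, Finset.mem_filter.2 ⟨hc, hce⟩⟩
      have hEcard : E.card = B''.card :=
        Finset.card_image_of_injective _ (add_left_injective _)
      have hdisj : Disjoint A E := by
        rw [Finset.disjoint_right]
        intro y hy
        obtain ⟨x, hx, rfl⟩ := Finset.mem_image.1 hy
        exact (Finset.mem_filter.1 hx).2
      obtain ⟨C, hC, habC, hCcard⟩ := ih B'.card (by omega) (A := A ∪ E) (B := B') rfl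
        (Finset.mem_union_left _ ha) hbB'
      refine ⟨C, hC.trans ?_, habC, ?_⟩
      · intro y hy
        obtain ⟨x, hx, z, hz, rfl⟩ := Finset.mem_add.1 hy
        rw [Finset.mem_filter] at hz
        rcases Finset.mem_union.1 hx with hx | hx
        · exact Finset.add_mem_add hx hz.1
        · obtain ⟨w, hw, rfl⟩ := Finset.mem_image.1 hx
          rw [show w + (e - b) + z = (z + (e - b)) + w by abel]
          exact Finset.add_mem_add hz.2 (Finset.mem_filter.1 hw).1
      · rw [Finset.card_union_of_disjoint hdisj] at hCcard
        omega

/-- A + B is a union of the pieces found around its individual elements, and the bound passes to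
unions. -/
theorem card_add_card_le_card_add_periods {A B : Finset G} (hA : A.Nonempty) (hB : B.Nonempty) :
    A.card + B.card ≤ (A + B).card + (periods (A + B)).card := by
  have key : ∀ F : Finset G, F.Nonempty → F ⊆ A + B → ∃ C ⊆ A + B, F ⊆ C ∧
      A.card + B.card ≤ C.card + (periods C).card := by
    intro F hF
    induction hF using Finset.Nonempty.cons_induction with
    | singleton c =>
      intro hc
      obtain ⟨a, ha, b, hb, rfl⟩ := Finset.mem_add.1 (Finset.singleton_subset_iff.1 hc)
      obtain ⟨C, hC, h1, h2⟩ := exists_subset_add_le_card_add_card_periods _ rfl ha hb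
      exact ⟨C, hC, Finset.singleton_subset_iff.2 h1, h2⟩
    | cons c F hcF hF ih =>
      intro hc
      rw [Finset.cons_subset] at hc
      obtain ⟨C₁, hC₁, h1, h2⟩ := ih hc.2
      obtain ⟨a, ha, b, hb, rfl⟩ := Finset.mem_add.1 hc.1
      obtain ⟨C₂, hC₂, h3, h4⟩ := exists_subset_add_le_card_add_card_periods _ rfl ha hb
      refine ⟨C₁ ∪ C₂, Finset.union_subset hC₁ hC₂, ?_, le_card_union_add_card_periods h2 h4⟩
      rw [Finset.cons_subset]
      exact ⟨Finset.mem_union_right _ h3, h1.trans Finset.subset_union_left⟩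
  obtain ⟨C, h1, h2, h3⟩ := key _ (hA.add hB) subset_rfl
  rwa [Finset.Subset.antisymm h1 h2] at h3

/-- **Kneser's theorem** for finite abelian groups. -/
theorem kneser {A B : Finset G} (hA : A.Nonempty) (hB : B.Nonempty) :
    (A + periods (A + B)).card + (B + periods (A + B)).card ≤
      (A + B).card + (periods (A + B)).card := by
  have hH : (periods (A + B)).Nonempty := ⟨0, zero_mem_periods _⟩
  have key : A + periods (A + B) + (B + periods (A + B)) = A + B := by
    apply Finset.Subset.antisymm
    · intro y hy
      obtain ⟨u, hu, v, hv, rfl⟩ := Finset.mem_add.1 hy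
      obtain ⟨a, ha, g, hg, rfl⟩ := Finset.mem_add.1 hu
      obtain ⟨b, hb, h, hh, rfl⟩ := Finset.mem_add.1 hv
      rw [show a + g + (b + h) = (g + h) + (a + b) by abel,
        mem_periods.1 (add_mem_periods hg hh)]
      exact Finset.add_mem_add ha hb
    · intro y hy
      obtain ⟨a, ha, b, hb, rfl⟩ := Finset.mem_add.1 hy
      refine Finset.add_mem_add ?_ ?_
      · simpa using Finset.add_mem_add ha (zero_mem_periods (A + B))
      · simpa using Finset.add_mem_add hb (zero_mem_periods (A + B))
  have h := card_add_card_le_card_add_periods (hA.add hH) (hB.add hH)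
  rwa [key] at h

end Kneser

/-! ### The Lev–Smeliansky bound -/

section LevSmeliansky

/-- X + H contains the whole coset a + H together with the part of `X` outside it. -/
theorem card_filter_add_card_le_card_add_periods {G : Type*} [AddCommGroup G] [Fintype G]
    [DecidableEq G] {X C : Finset G} {a : G} (ha : a ∈ X) :
    X.card + (periods C).card ≤
      (X + periods C).card + (X.filter fun x => x - a ∈ periods C).card := by
  have h1 : (X.filter fun x => x - a ∈ periods C).card +
      (X.filter fun x => ¬ x - a ∈ periods C).card = X.card :=
    Finset.card_filter_add_card_filter_not _
  have h2 : ((periods C).image fun g => a + g).card = (periods C).card :=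
    Finset.card_image_of_injective _ (add_right_injective a)
  have h3 : Disjoint (X.filter fun x => ¬ x - a ∈ periods C)
      ((periods C).image fun g => a + g) := by
    rw [Finset.disjoint_right]
    intro y hy hy'
    obtain ⟨g, hg, rfl⟩ := Finset.mem_image.1 hy
    exact (Finset.mem_filter.1 hy').2 (by simpa using hg)
  have h4 : (X.filter fun x => ¬ x - a ∈ periods C) ∪ ((periods C).image fun g => a + g) ⊆
      X + periods C := by
    intro y hy
    rcases Finset.mem_union.1 hy with hy | hy
    · simpa using Finset.add_mem_add (Finset.mem_filter.1 hy).1 (zero_mem_periods C)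
    · obtain ⟨g, hg, rfl⟩ := Finset.mem_image.1 hy
      exact Finset.add_mem_add ha hg
  have h5 := Finset.card_le_card h4
  rw [Finset.card_union_of_disjoint h3] at h5
  omega

/-- If the integers in `A` have no common divisor, a nonempty set of residues modulo `l` having all
elements of `A` as periods is everything. -/
theorem eq_univ_of_cast_mem_periods {A : Finset ℤ} {l : ℕ} [NeZero l]
    (hgcd : ∀ d : ℕ, (∀ a ∈ A, (d : ℤ) ∣ a) → d = 1) {D : Finset (ZMod l)} (hD : D.Nonempty)
    (h : ∀ a ∈ A, (a : ZMod l) ∈ periods D) : D = Finset.univ := by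
  let P : AddSubgroup ℤ :=
    { carrier := {n | (n : ZMod l) ∈ periods D}
      zero_mem' := by simpa using zero_mem_periods D
      add_mem' := fun {x y} hx hy => by
        simpa using add_mem_periods (C := D) hx hy
      neg_mem' := fun {x} hx => by
        simpa using neg_mem_periods (C := D) hx }
  obtain ⟨g, hg⟩ := Int.subgroup_cyclic P
  have hmem : ∀ n : ℤ, n ∈ P ↔ g ∣ n := by
    intro n
    rw [hg, ← AddSubgroup.zmultiples_eq_closure, Int.mem_zmultiples_iff]
  have hg1 : g.natAbs = 1 := hgcd _ fun a ha => by
    rw [Int.natAbs_dvd]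
    exact (hmem a).1 (h a ha)
  have hall : ∀ n : ℤ, (n : ZMod l) ∈ periods D := fun n =>
    (hmem n).2 (Int.natAbs_dvd.1 (by rw [hg1]; simp))
  obtain ⟨d, hd⟩ := hD
  refine Finset.eq_univ_iff_forall.2 fun x => ?_
  obtain ⟨n, hn⟩ := ZMod.intCast_surjective (x - d)
  have := (mem_periods.1 (hall n) d).2 hd
  rwa [hn, sub_add_cancel] at this

/-- A theorem of Lev and Smeliansky: a lower bound for the size of `A + B` where `A` is a set of
integers with minimum `0`, maximum `l` and no common divisor, and `B` is injective modulo `l`. -/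
theorem lev_smeliansky {A B : Finset ℤ} {l : ℕ} (hl : 0 < l) (h0 : (0 : ℤ) ∈ A)
    (hlA : (l : ℤ) ∈ A) (hA : ∀ a ∈ A, 0 ≤ a ∧ a ≤ l)
    (hgcd : ∀ d : ℕ, (∀ a ∈ A, (d : ℤ) ∣ a) → d = 1) (hB : B.Nonempty)
    (hinj : Set.InjOn (Int.cast : ℤ → ZMod l) B) :
    l + B.card ≤ (A + B).card ∨ A.card + 2 * B.card ≤ (A + B).card + 2 := by
  have : NeZero l := ⟨hl.ne'⟩
  set π : ℤ → ZMod l := Int.cast with hπ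
  set C := A + B with hC
  set A' := A.image π with hA'
  set B' := B.image π with hB'
  have hAne : A.Nonempty := ⟨0, h0⟩
  have hmemC : ∀ x ∈ A', ∀ y ∈ B', ∃ c ∈ C, π c = x + y := by
    intro x hx y hy
    obtain ⟨a, ha, rfl⟩ := Finset.mem_image.1 hx
    obtain ⟨b, hb, rfl⟩ := Finset.mem_image.1 hy
    exact ⟨a + b, Finset.add_mem_add ha hb, by simp [hπ]⟩
  have hA0 : (0 : ZMod l) ∈ A' := Finset.mem_image.2 ⟨0, h0, by simp [hπ]⟩
  have hBC : B' ⊆ A' + B' := fun b hb => by simpa using Finset.add_mem_add hA0 hb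
  have hB'card : B'.card = B.card := Finset.card_image_of_injOn hinj
  -- The loss of one is the collision of 0 and l modulo l.
  have hA'card : A.card ≤ A'.card + 1 := by
    rw [← Finset.card_erase_add_one hlA]
    refine Nat.add_le_add_right ?_ 1
    refine Finset.card_le_card_of_injOn π
      (fun a ha => Finset.mem_image_of_mem _ (Finset.mem_of_mem_erase ha)) ?_
    intro x hx y hy hxy
    have hx' := Finset.mem_erase.1 hx
    have hy' := Finset.mem_erase.1 hy
    have b1 := hA x hx'.2
    have b2 := hA y hy'.2
    have b3 := lt_of_le_of_ne b1.2 hx'.1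
    have b4 := lt_of_le_of_ne b2.2 hy'.1
    rw [hπ, ZMod.intCast_eq_intCast_iff, Int.ModEq, Int.emod_eq_of_lt b1.1 b3,
      Int.emod_eq_of_lt b2.1 b4] at hxy
    exact hxy
  -- residues in `A' + B'` are hit at least once, those in `B'` at least twice
  have hfib : ∀ T ⊆ A' + B', T.card + (T ∩ B').card ≤ (C.filter fun c => π c ∈ T).card := by
    intro T hT
    rw [Finset.card_eq_sum_card_fiberwise (s := C.filter fun c => π c ∈ T) (f := π) (t := T)
      (fun c hc => (Finset.mem_filter.1 hc).2)]
    rw [← Finset.filter_mem_eq_inter, Finset.card_filter, Finset.card_eq_sum_ones,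
      ← Finset.sum_add_distrib]
    refine Finset.sum_le_sum fun ρ hρ => ?_
    split_ifs with hρB
    · obtain ⟨b, hb, hbρ⟩ := Finset.mem_image.1 hρB
      have hsub : ({b, (l : ℤ) + b} : Finset ℤ) ⊆
          {c ∈ C.filter fun c => π c ∈ T | π c = ρ} := by
        intro c hc
        have hc' : π c = ρ ∧ c ∈ C := by
          rcases Finset.mem_insert.1 hc with rfl | hc
          · exact ⟨hbρ, by simpa using Finset.add_mem_add h0 hb⟩
          · rw [Finset.mem_singleton] at hc
            subst hc
            exact ⟨by rw [← hbρ]; simp [hπ], Finset.add_mem_add hlA hb⟩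
        rw [Finset.mem_filter, Finset.mem_filter, hc'.1]
        exact ⟨⟨hc'.2, hρ⟩, rfl⟩
      have := Finset.card_le_card hsub
      rw [Finset.card_pair (by omega)] at this
      omega
    · rw [add_zero, Nat.one_le_iff_ne_zero, ← Nat.pos_iff_ne_zero, Finset.card_pos]
      obtain ⟨x, hx, y, hy, hxy⟩ := Finset.mem_add.1 (hT hρ)
      obtain ⟨c, hc, hcxy⟩ := hmemC x hx y hy
      refine ⟨c, ?_⟩
      rw [Finset.mem_filter, Finset.mem_filter, hcxy, hxy]
      exact ⟨⟨hc, hρ⟩, rfl⟩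
  set H := periods (A' + B') with hH
  have hne : A'.Nonempty := hAne.image _
  have hBne : B'.Nonempty := hB.image _
  -- Either B' + H is stable under translation by A, hence everything, or some coset a + b + H
  -- inside A' + B' misses B'.
  by_cases hcase : ∀ x ∈ A', ∀ y ∈ B', x + y ∈ B' + H
  · left
    have hper : ∀ a ∈ A, (a : ZMod l) ∈ periods (B' + H) := by
      intro a ha
      refine mem_periods_of_forall fun c hc => ?_
      obtain ⟨b, hb, h, hh, rfl⟩ := Finset.mem_add.1 hc
      obtain ⟨b', hb', h', hh', hbh⟩ :=
        Finset.mem_add.1 (hcase a (Finset.mem_image_of_mem _ ha) b hb)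
      rw [← add_assoc, ← hbh, add_assoc]
      exact Finset.add_mem_add hb' (add_mem_periods hh' hh)
    have hD := eq_univ_of_cast_mem_periods hgcd
      (hBne.add ⟨0, zero_mem_periods (A' + B')⟩) hper
    have hCuniv : A' + B' = Finset.univ := by
      refine Finset.eq_univ_iff_forall.2 fun x => ?_
      have hx : x ∈ B' + H := by rw [hD]; exact Finset.mem_univ x
      obtain ⟨b, hb, h, hh, rfl⟩ := Finset.mem_add.1 hx
      rw [add_comm b, mem_periods.1 hh]
      exact hBC hb
    have h1 := hfib Finset.univ hCuniv.ge
    rw [Finset.univ_inter, hB'card, Finset.card_univ, ZMod.card] at h1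
    exact h1.trans (Finset.card_filter_le _ _)
  · right
    push Not at hcase
    obtain ⟨a, ha, b, hb, hab⟩ := hcase
    have hkn := kneser hne hBne
    have k1 := card_filter_add_card_le_card_add_periods (C := A' + B') ha
    have k2 := card_filter_add_card_le_card_add_periods (C := A' + B') hb
    rw [← hH] at hkn k1 k2
    set K := H.image fun g => a + b + g with hK
    have hKcard : K.card = H.card := Finset.card_image_of_injective _ (add_right_injective _)
    have hKC : K ⊆ A' + B' := by
      intro y hy
      obtain ⟨g, hg, rfl⟩ := Finset.mem_image.1 hy
      rw [add_comm (a + b), mem_periods.1 hg]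
      exact Finset.add_mem_add ha hb
    have hKB : B' ⊆ ((A' + B') \ K) ∩ B' := by
      intro y hy
      rw [Finset.mem_inter, Finset.mem_sdiff]
      refine ⟨⟨hBC hy, fun hyK => hab ?_⟩, hy⟩
      obtain ⟨g, hg, rfl⟩ := Finset.mem_image.1 hyK
      simpa using Finset.add_mem_add hy (neg_mem_periods hg)
    have c1 := hfib ((A' + B') \ K) Finset.sdiff_subset
    have c2 := Finset.card_le_card hKB
    have c3 : ((A' + B') \ K).card + K.card = (A' + B').card :=
      Finset.card_sdiff_add_card_eq_card hKC
    have c4 : (C.filter fun c => π c ∈ K).card + (C.filter fun c => π c ∈ (A' + B') \ K).card ≤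
        C.card := by
      rw [← Finset.card_union_of_disjoint]
      · exact Finset.card_le_card
          (Finset.union_subset (Finset.filter_subset _ _) (Finset.filter_subset _ _))
      · rw [Finset.disjoint_filter]
        intro c _ h1 h2
        exact (Finset.mem_sdiff.1 h2).2 h1
    set Aa := A.filter fun x => π x - a ∈ H with hAa
    set Bb := B.filter fun x => π x - b ∈ H with hBb
    have d1 : (A'.filter fun x => x - a ∈ H).card ≤ Aa.card := by
      rw [hA', Finset.filter_image]
      exact Finset.card_image_le
    have d2 : (B'.filter fun x => x - b ∈ H).card ≤ Bb.card := by
      rw [hB', Finset.filter_image]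
      exact Finset.card_image_le
    have d3 : Aa + Bb ⊆ C.filter fun c => π c ∈ K := by
      intro y hy
      obtain ⟨u, hu, v, hv, rfl⟩ := Finset.mem_add.1 hy
      rw [Finset.mem_filter] at hu hv ⊢
      refine ⟨Finset.add_mem_add hu.1 hv.1, Finset.mem_image.2
        ⟨(π u - a) + (π v - b), add_mem_periods hu.2 hv.2, ?_⟩⟩
      simp only [hπ, Int.cast_add]
      abel
    have hAane : Aa.Nonempty := by
      obtain ⟨x, hx, hxa⟩ := Finset.mem_image.1 ha
      exact ⟨x, Finset.mem_filter.2 ⟨hx, by rw [hxa, sub_self]; exact zero_mem_periods _⟩⟩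
    have hBbne : Bb.Nonempty := by
      obtain ⟨x, hx, hxa⟩ := Finset.mem_image.1 hb
      exact ⟨x, Finset.mem_filter.2 ⟨hx, by rw [hxa, sub_self]; exact zero_mem_periods _⟩⟩
    have d4 := cauchy_davenport_add_of_linearOrder_isCancelAdd hAane hBbne
    have d5 := Finset.card_le_card d3
    -- Outside `K` the fibre count gives |A' + B'| − |H| + |B|; above `K` there are at least |Aa| +
    -- |Bb| − 1 integers, which cancels the deficits in `k1` and `k2`. The final 2 combines this 1
    -- with the one in `hA'card`.
    omega

end LevSmeliansky

/-! ### Sums of dilates r·A + A -/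

section Dilates

theorem card_add_card_le_card_add {A B : Finset ℤ} (hA : A.Nonempty) (hB : B.Nonempty) :
    A.card + B.card ≤ (A + B).card + 1 := by
  have := cauchy_davenport_add_of_linearOrder_isCancelAdd hA hB
  omega

theorem card_image_mul {r : ℤ} (hr : r ≠ 0) (A : Finset ℤ) :
    (A.image fun x => r * x).card = A.card :=
  Finset.card_image_of_injective _ (mul_right_injective₀ hr)

/-- Since r·A + A is a disjoint union over residues j mod r, the bounds for A + F j add up. The
coprimality of A forces at least two residues, and three already give 4|A| − 3. -/
theorem dilate_normalized {A : Finset ℤ} {l : ℕ} {r : ℤ} (hr : 2 ≤ r) (hl : 0 < l)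
    (h0 : (0 : ℤ) ∈ A) (hlA : (l : ℤ) ∈ A) (hA : ∀ a ∈ A, 0 ≤ a ∧ a ≤ l)
    (hgcd : ∀ d : ℕ, (∀ a ∈ A, (d : ℤ) ∣ a) → d = 1) :
    4 * A.card ≤ (A.image (fun x => r * x) + A).card + 4 ∨
      (l + 2 * A.card ≤ (A.image (fun x => r * x) + A).card + 1 ∧
        (4 ≤ r → 2 * A.card ≤ l + 4)) := by
  set C := A.image (fun x => r * x) + A with hC
  set R := A.image (fun x => x % r) with hR
  -- A is the disjoint union of the sets r·F j + j, and r·A + A contains r·(A + F j) + j. Each `F j`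
  -- lies in [0, l), so it is injective modulo l.
  let F : ℤ → Finset ℤ := fun j => (A.filter fun x => x % r = j).image fun x => x / r
  have hAne : A.Nonempty := ⟨0, h0⟩
  have hF : ∀ j, ∀ z ∈ F j, r * z + j ∈ A ∧ 0 ≤ z ∧ z < l := by
    intro j z hz
    obtain ⟨x, hx, rfl⟩ := Finset.mem_image.1 hz
    rw [Finset.mem_filter] at hx
    have h1 := hA x hx.1
    rw [← hx.2, Int.mul_ediv_add_emod]
    refine ⟨hx.1, Int.ediv_nonneg h1.1 (by omega), ?_⟩
    refine Int.ediv_lt_of_lt_mul (by omega) ?_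
    nlinarith
  have hFcard : ∀ j, (F j).card = (A.filter fun x => x % r = j).card := by
    intro j
    refine Finset.card_image_of_injOn fun x hx y hy hxy => ?_
    have hx' := (Finset.mem_filter.1 hx).2
    have hy' := (Finset.mem_filter.1 hy).2
    have hxy' : x / r = y / r := hxy
    rw [← Int.mul_ediv_add_emod x r, ← Int.mul_ediv_add_emod y r, hx', hy', hxy']
  have hsum : ∑ j ∈ R, (F j).card = A.card := by
    rw [Finset.card_eq_sum_card_fiberwise (f := fun x => x % r) (t := R)
      (fun x hx => Finset.mem_image_of_mem _ hx)]
    exact Finset.sum_congr rfl fun j _ => hFcard j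
  have hFne : ∀ j ∈ R, (F j).Nonempty := by
    intro j hj
    obtain ⟨x, hx, rfl⟩ := Finset.mem_image.1 hj
    exact ⟨x / r, Finset.mem_image.2 ⟨x, Finset.mem_filter.2 ⟨hx, rfl⟩, rfl⟩⟩
  have hCsum : ∑ j ∈ R, (A + F j).card ≤ C.card := by
    refine le_trans ?_ ((Finset.sum_card_fiberwise_eq_card_filter C R fun c => c % r).trans_le
      (Finset.card_filter_le _ _))
    refine Finset.sum_le_sum fun j hj => ?_
    obtain ⟨x, hx, hxj⟩ := Finset.mem_image.1 hj
    refine Finset.card_le_card_of_injOn (fun z => r * z + j) ?_ ?_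
    · intro z hz
      obtain ⟨u, hu, v, hv, rfl⟩ := Finset.mem_add.1 hz
      refine Finset.mem_filter.2 ⟨?_, ?_⟩
      · change r * (u + v) + j ∈ C
        rw [mul_add, add_assoc]
        exact Finset.add_mem_add (Finset.mem_image_of_mem _ hu) (hF j v hv).1
      · change (r * (u + v) + j) % r = j
        rw [Int.mul_add_emod_self_left, ← hxj, Int.emod_emod]
    · intro z _ w _ hzw
      exact mul_left_cancel₀ (by omega : r ≠ 0) (add_right_cancel hzw)
  have hCD : ∀ j ∈ R, A.card + (F j).card ≤ (A + F j).card + 1 := fun j hj =>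
    card_add_card_le_card_add hAne (hFne j hj)
  have hLS : ∀ j ∈ R, l + (F j).card ≤ (A + F j).card ∨
      A.card + 2 * (F j).card ≤ (A + F j).card + 2 := by
    intro j hj
    refine lev_smeliansky hl h0 hlA hA hgcd (hFne j hj) ?_
    intro x hx y hy hxy
    have hx' := (hF j x hx).2
    have hy' := (hF j y hy).2
    rw [ZMod.intCast_eq_intCast_iff, Int.ModEq, Int.emod_eq_of_lt hx'.1 hx'.2,
      Int.emod_eq_of_lt hy'.1 hy'.2] at hxy
    exact hxy
  have hF4 : 4 ≤ r → ∀ j ∈ R, (F j).card ≤ l / 4 + 1 := by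
    intro hr4 j hj
    obtain ⟨x, hx, hxj⟩ := Finset.mem_image.1 hj
    have hj0 : 0 ≤ j := by
      rw [← hxj]
      exact Int.emod_nonneg _ (by omega)
    have hsub : F j ⊆ Finset.Icc 0 ((l / 4 : ℕ) : ℤ) := by
      intro z hz
      have h1 := hF j z hz
      have h2 := hA _ h1.1
      have h3 : 4 * z ≤ r * z := mul_le_mul_of_nonneg_right hr4 h1.2.1
      rw [Finset.mem_Icc]
      omega
    have h4 := Finset.card_le_card hsub
    rw [Int.card_Icc] at h4
    omega
  have hRcard : 2 ≤ R.card := by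
    by_contra! hcon
    have h0R : (0 : ℤ) ∈ R := Finset.mem_image.2 ⟨0, h0, by simp⟩
    have hall : ∀ a ∈ A, (r.natAbs : ℤ) ∣ a := by
      intro a ha
      have h1 := Finset.card_le_one.1 (by omega : R.card ≤ 1) _
        (Finset.mem_image_of_mem (fun x => x % r) ha) 0 h0R
      rw [Int.natAbs_dvd]
      exact Int.dvd_of_emod_eq_zero h1
    have := hgcd _ hall
    omega
  have hk : 1 ≤ A.card := Finset.card_pos.2 hAne
  -- With two residues, the second Lev–Smeliansky alternative for both sums to 4|A| − 4. Otherwise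
  -- one class gives l + |F i|, and the trivial bound |A| + |F j| − 1 for the other completes l +
  -- 2|A| − 1.
  rcases hRcard.eq_or_lt with h2 | h3
  · obtain ⟨i, j, hij, hRij⟩ := Finset.card_eq_two.1 h2.symm
    rw [hRij, Finset.sum_pair hij] at hCsum hsum
    have hi : i ∈ R := by rw [hRij]; simp
    have hj : j ∈ R := by rw [hRij]; simp
    have := hCD i hi
    have := hCD j hj
    have := hLS i hi
    have := hLS j hj
    by_cases hr4 : 4 ≤ r
    · have := hF4 hr4 i hi
      have := hF4 hr4 j hj
      omega
    · omega
  · left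
    have h4 := Finset.sum_le_sum hCD
    rw [Finset.sum_add_distrib, Finset.sum_add_distrib, Finset.sum_const, Finset.sum_const, hsum,
      smul_eq_mul, smul_eq_mul] at h4
    nlinarith

/-- A finite set of at least two integers is an affine image of a set with minimum `0` and trivial
common divisor. -/
theorem exists_normalization {A : Finset ℤ} (hA : 2 ≤ A.card) :
    ∃ (u d : ℤ) (l : ℕ) (B : Finset ℤ), 0 < d ∧ A = B.image (fun x => u + d * x) ∧ 0 < l ∧
      (0 : ℤ) ∈ B ∧ (l : ℤ) ∈ B ∧ (∀ b ∈ B, 0 ≤ b ∧ b ≤ l) ∧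
      ∀ n : ℕ, (∀ b ∈ B, (n : ℤ) ∣ b) → n = 1 := by
  have hne : A.Nonempty := Finset.card_pos.1 (by omega)
  set u := A.min' hne with hu
  set d : ℤ := A.gcd (fun x => x - u) with hd
  have hdvd : ∀ x ∈ A, d ∣ x - u := fun x hx => Finset.gcd_dvd hx
  obtain ⟨x, hx, hxu⟩ : ∃ x ∈ A, x ≠ u := Finset.exists_mem_ne (by omega) u
  have hd0 : d ≠ 0 := by
    intro h
    have := hdvd x hx
    rw [h, zero_dvd_iff] at this
    omega
  have hdpos : 0 < d := by
    have h1 : normalize d = d := Finset.normalize_gcd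
    have := Int.nonneg_of_normalize_eq_self h1
    omega
  set B := A.image (fun x => (x - u) / d) with hB
  have hmul : ∀ x ∈ A, u + d * ((x - u) / d) = x := by
    intro x hx
    rw [Int.mul_ediv_cancel' (hdvd x hx)]
    ring
  have hAB : A = B.image (fun x => u + d * x) := by
    rw [hB, Finset.image_image]
    conv_lhs => rw [← Finset.image_id (s := A)]
    exact Finset.image_congr fun x hx => (hmul x hx).symm
  have hmono : ∀ x ∈ A, ∀ y ∈ A, x ≤ y → (x - u) / d ≤ (y - u) / d := fun x _ y _ hxy =>
    Int.ediv_le_ediv hdpos (by omega)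
  set v := A.max' hne with hv
  have huA : u ∈ A := Finset.min'_mem _ _
  have hvA : v ∈ A := Finset.max'_mem _ _
  have hl0 : 0 ≤ (v - u) / d := by
    simpa using hmono u huA v hvA (Finset.min'_le _ _ hvA)
  refine ⟨u, d, ((v - u) / d).toNat, B, hdpos, hAB, ?_, ?_, ?_, ?_, ?_⟩
  · have h1 := hmul v hvA
    have h2 : u < x := lt_of_le_of_ne (Finset.min'_le _ _ hx) hxu.symm
    have h3 : x ≤ v := Finset.le_max' _ _ hx
    have h4 : 0 < (v - u) / d := by
      by_contra hcon
      have h5 : (v - u) / d = 0 := by omega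
      rw [h5] at h1
      omega
    omega
  · exact Finset.mem_image.2 ⟨u, huA, by simp⟩
  · rw [Int.toNat_of_nonneg hl0]
    exact Finset.mem_image_of_mem _ hvA
  · intro b hb
    obtain ⟨y, hy, rfl⟩ := Finset.mem_image.1 hb
    rw [Int.toNat_of_nonneg hl0]
    refine ⟨?_, hmono y hy v hvA (Finset.le_max' _ _ hy)⟩
    simpa using hmono u huA y hy (Finset.min'_le _ _ hy)
  · intro n hn
    have h1 : d * n ∣ d := by
      conv_rhs => rw [hd]
      refine Finset.dvd_gcd fun y hy => ?_
      obtain ⟨c, hc⟩ := hn _ (Finset.mem_image_of_mem _ hy)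
      refine ⟨c, ?_⟩
      rw [mul_assoc, ← hc]
      have := hmul y hy
      linarith
    have h2 : (n : ℤ) ∣ 1 := by
      obtain ⟨c, hc⟩ := h1
      refine ⟨c, mul_left_cancel₀ hd0 ?_⟩
      rw [← mul_assoc, ← hc, mul_one]
    exact Nat.dvd_one.1 (by exact_mod_cast h2)

theorem card_dilate_affine (B : Finset ℤ) (r u : ℤ) {d : ℤ} (hd : 0 < d) :
    ((B.image fun x => u + d * x).image (fun x => r * x) + B.image fun x => u + d * x).card =
      (B.image (fun x => r * x) + B).card := by
  have h : (B.image fun x => u + d * x).image (fun x => r * x) + (B.image fun x => u + d * x) =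
      (B.image (fun x => r * x) + B).image (fun z => r * u + u + d * z) := by
    ext z
    simp only [Finset.mem_add, Finset.mem_image]
    constructor
    · rintro ⟨_, ⟨_, ⟨a, ha, rfl⟩, rfl⟩, _, ⟨b, hb, rfl⟩, rfl⟩
      exact ⟨r * a + b, ⟨r * a, ⟨a, ha, rfl⟩, b, hb, rfl⟩, by ring⟩
    · rintro ⟨_, ⟨_, ⟨a, ha, rfl⟩, b, hb, rfl⟩, rfl⟩
      exact ⟨_, ⟨_, ⟨a, ha, rfl⟩, rfl⟩, _, ⟨b, hb, rfl⟩, by ring⟩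
  rw [h]
  refine Finset.card_image_of_injective _ fun x y hxy => ?_
  have h1 : d * x = d * y := add_left_cancel hxy
  exact mul_left_cancel₀ hd.ne' h1

/-- The inverse theorem for sums of dilates `r • A + A`, `r ≥ 2`. -/
theorem exists_progression_of_dilate {A : Finset ℤ} {r : ℤ} (hr : 2 ≤ r) (hA : 2 ≤ A.card) :
    ∃ (u d : ℤ) (l : ℕ), 0 < d ∧ 0 < l ∧
      (∀ a ∈ A, ∃ i : ℕ, i ≤ l ∧ a = u + i * d) ∧ A.card ≤ l + 1 ∧
      (4 * A.card ≤ (A.image (fun x => r * x) + A).card + 4 ∨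
        l + 2 * A.card ≤ (A.image (fun x => r * x) + A).card + 1 ∧
          (4 ≤ r → 2 * A.card ≤ l + 4)) := by
  obtain ⟨u, d, l, B, hd, rfl, hl, h0, hlB, hB, hgcd⟩ := exists_normalization hA
  have hcard : (B.image fun x => u + d * x).card = B.card :=
    Finset.card_image_of_injective _ fun x y hxy =>
      mul_left_cancel₀ hd.ne' (add_left_cancel (a := u) hxy)
  refine ⟨u, d, l, hd, hl, ?_, ?_, ?_⟩
  · intro a ha
    obtain ⟨b, hb, rfl⟩ := Finset.mem_image.1 ha
    obtain ⟨h1, h2⟩ := hB b hb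
    obtain ⟨n, rfl⟩ := Int.eq_ofNat_of_zero_le h1
    exact ⟨n, by omega, by simp; ring⟩
  · rw [hcard]
    have : B ⊆ Finset.Icc 0 (l : ℤ) := fun b hb => Finset.mem_Icc.2 (hB b hb)
    simpa using Finset.card_le_card this
  · rw [card_dilate_affine _ _ _ hd, hcard]
    exact dilate_normalized hr hl h0 hlB hB hgcd

theorem three_mul_card_le_card_dilate {A : Finset ℤ} {r : ℤ} (hr : 2 ≤ r) (hA : A.Nonempty) :
    3 * A.card ≤ (A.image (fun x => r * x) + A).card + 2 := by
  have h1 : 1 ≤ A.card := Finset.card_pos.2 hA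
  rcases h1.eq_or_lt with h | h
  · have h2 := card_add_card_le_card_add (hA.image fun x => r * x) hA
    rw [card_image_mul (by omega)] at h2
    omega
  · obtain ⟨u, d, l, -, -, -, h2, h3⟩ := exists_progression_of_dilate hr h
    omega

/-- For r ≥ 4 two residue classes hold at most about l/2 elements, so the progression alternative is
expensive too. This excludes levels m ≥ 2 from the small doubling range. -/
theorem four_mul_card_le_card_dilate {A : Finset ℤ} {r : ℤ} (hr : 4 ≤ r) (hA : 2 ≤ A.card) :
    4 * A.card ≤ (A.image (fun x => r * x) + A).card + 5 ∧
      2 * A.card ≤ (A.image (fun x => r * x) + A).card := by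
  obtain ⟨u, d, l, -, h1, -, h2, h3⟩ := exists_progression_of_dilate (by omega : 2 ≤ r) hA
  omega

end Dilates

/-! ### A parity bound for level 0 -/

section Parity

/-- As r is even, A ∩ r·A contains only even elements, so |A ∪ r·A| ≥ 2|A| − |E|. In A + A, the odd
sums E + O are disjoint from the even sums (E + E) ∪ (O + O). A large E hurts the first count but
helps the second. -/
theorem seven_mul_card_le_of_odd_mem {A : Finset ℤ} {r : ℤ} (hr : r ≠ 0) (hr2 : 2 ∣ r)
    (hodd : ∃ a ∈ A, ¬ (2 : ℤ) ∣ a) :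
    7 * A.card ≤ 2 * ((A + A).card + (A ∪ A.image fun x => r * x).card) + 3 := by
  set E := A.filter fun x => (2 : ℤ) ∣ x with hE
  set O := A.filter fun x => ¬ (2 : ℤ) ∣ x with hO
  have hEO : E.card + O.card = A.card := Finset.card_filter_add_card_filter_not _
  have hOne : O.Nonempty := by
    obtain ⟨a, ha, h⟩ := hodd
    exact ⟨a, Finset.mem_filter.2 ⟨ha, h⟩⟩
  have hAne : A.Nonempty := hOne.mono (Finset.filter_subset _ _)
  have hinter : (A ∩ A.image fun x => r * x).card ≤ E.card := by
    refine Finset.card_le_card fun x hx => ?_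
    rw [Finset.mem_inter] at hx
    obtain ⟨y, hy, rfl⟩ := Finset.mem_image.1 hx.2
    exact Finset.mem_filter.2 ⟨hx.1, hr2.mul_right y⟩
  have hunion := Finset.card_union_add_card_inter A (A.image fun x => r * x)
  rw [card_image_mul hr] at hunion
  have hO1 : 1 ≤ O.card := Finset.card_pos.2 hOne
  rcases E.eq_empty_or_nonempty with hE0 | hEne
  · rw [hE0, Finset.card_empty] at hinter hEO
    have := card_add_card_le_card_add hAne hAne
    omega
  have h1 := card_add_card_le_card_add hEne hEne
  have h2 := card_add_card_le_card_add hOne hOne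
  have h3 := card_add_card_le_card_add hEne hOne
  have hE1 : 1 ≤ E.card := Finset.card_pos.2 hEne
  have hdisj : Disjoint ((E + E) ∪ (O + O)) (E + O) := by
    rw [Finset.disjoint_right]
    intro z hz hz'
    obtain ⟨x, hx, y, hy, rfl⟩ := Finset.mem_add.1 hz
    have hx := (Finset.mem_filter.1 hx).2
    have hy := (Finset.mem_filter.1 hy).2
    rcases Finset.mem_union.1 hz' with h | h
    · obtain ⟨u, hu, v, hv, huv⟩ := Finset.mem_add.1 h
      have hu := (Finset.mem_filter.1 hu).2
      have hv := (Finset.mem_filter.1 hv).2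
      omega
    · obtain ⟨u, hu, v, hv, huv⟩ := Finset.mem_add.1 h
      have hu := (Finset.mem_filter.1 hu).2
      have hv := (Finset.mem_filter.1 hv).2
      omega
  have hsub : ((E + E) ∪ (O + O)) ∪ (E + O) ⊆ A + A := by
    refine Finset.union_subset (Finset.union_subset ?_ ?_) ?_ <;>
      exact Finset.add_subset_add (Finset.filter_subset _ _) (Finset.filter_subset _ _)
  have h4 := Finset.card_le_card hsub
  rw [Finset.card_union_of_disjoint hdisj] at h4
  have h5 := Finset.card_le_card (Finset.subset_union_left (s₁ := E + E) (s₂ := O + O))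
  have h6 := Finset.card_le_card (Finset.subset_union_right (s₁ := E + E) (s₂ := O + O))
  -- the maxima of `E + E` and of `O + O` differ
  have h7 : E + E ≠ O + O := by
    intro heq
    have hm1 := E.max'_mem hEne
    have hm2 := O.max'_mem hOne
    obtain ⟨u, hu, v, hv, huv⟩ := Finset.mem_add.1 (heq ▸ Finset.add_mem_add hm1 hm1)
    obtain ⟨u', hu', v', hv', huv'⟩ := Finset.mem_add.1 (heq.symm ▸ Finset.add_mem_add hm2 hm2)
    have := O.le_max' u hu
    have := O.le_max' v hv
    have := E.le_max' u' hu'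
    have := E.le_max' v' hv'
    have e1 := (Finset.mem_filter.1 hm1).2
    have e2 := (Finset.mem_filter.1 hm2).2
    omega
  -- For |E| = |O| the count using 2|E| − 1 even sums falls short by one; the inequality of the two
  -- sumsets supplies it.
  have h8 : 2 * E.card ≤ ((E + E) ∪ (O + O)).card ∨ 2 * O.card ≤ ((E + E) ∪ (O + O)).card ∨
      E.card ≠ O.card := by
    by_contra! hcon
    have e1 : E + E = (E + E) ∪ (O + O) :=
      Finset.eq_of_subset_of_card_le Finset.subset_union_left (by omega)
    have e2 : O + O = (E + E) ∪ (O + O) :=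
      Finset.eq_of_subset_of_card_le Finset.subset_union_right (by omega)
    exact h7 (e1.trans e2.symm)
  omega

/-- Every cardinality involved is invariant under halving, so A can be halved until it has an odd
element or is {0}. -/
theorem seven_mul_card_le_card_add_add_card_union {A : Finset ℤ} {r : ℤ} (hA : A.Nonempty)
    (hr : r ≠ 0) (hr2 : 2 ∣ r) :
    7 * A.card ≤ 2 * ((A + A).card + (A ∪ A.image fun x => r * x).card) + 3 := by
  obtain ⟨N, hN⟩ : ∃ N : ℕ, ∀ a ∈ A, a.natAbs ≤ N :=
    ⟨A.sup Int.natAbs, fun a ha => Finset.le_sup (f := Int.natAbs) ha⟩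
  induction N using Nat.strong_induction_on generalizing A with
  | _ N ih =>
    by_cases hodd : ∃ a ∈ A, ¬ (2 : ℤ) ∣ a
    · exact seven_mul_card_le_of_odd_mem hr hr2 hodd
    push Not at hodd
    rcases Nat.eq_zero_or_pos N with rfl | hpos
    · have hA0 : A = {0} := by
        refine Finset.eq_singleton_iff_nonempty_unique_mem.2 ⟨hA, fun a ha => ?_⟩
        have := hN a ha
        omega
      subst hA0
      simp
    · set B := A.image fun x => x / 2 with hB
      have hAB : A = B.image fun x => 2 * x := by
        rw [hB, Finset.image_image]
        conv_lhs => rw [← Finset.image_id (s := A)]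
        exact Finset.image_congr fun x hx => (Int.mul_ediv_cancel' (hodd x hx)).symm
      have hBN : ∀ b ∈ B, b.natAbs ≤ N / 2 := by
        intro b hb
        obtain ⟨a, ha, rfl⟩ := Finset.mem_image.1 hb
        have := hN a ha
        have := hodd a ha
        omega
      have h := ih (N / 2) (by omega) (A := B) (hA.image _) hBN
      clear_value B
      have e1 : (A + A).card = (B + B).card := by
        have h1 : (B + B).image (fun x => 2 * x) =
            B.image (fun x => 2 * x) + B.image (fun x => 2 * x) :=
          Finset.image_add (β := ℤ) (AddMonoidHom.mulLeft (2 : ℤ))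
        rw [hAB, ← h1, card_image_mul two_ne_zero]
      have e2 : (A ∪ A.image fun x => r * x).card = (B ∪ B.image fun x => r * x).card := by
        have h1 : ((fun x : ℤ => r * x) ∘ fun x => 2 * x) = (fun x => 2 * x) ∘ fun x => r * x :=
          funext fun x => mul_left_comm r 2 x
        rw [← card_image_mul two_ne_zero (B ∪ _), Finset.image_union, Finset.image_image, ← h1,
          ← Finset.image_image, ← hAB]
      have e3 : A.card = B.card := by
        rw [hAB, card_image_mul two_ne_zero]
      rw [e1, e2, e3]
      exact h

end Parity

/-! ### Products and commutation in coordinates -/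

section Model

/-- The multiplication of `BS⁺(1, 2)` in the coordinates `(m, x) ↦ b ^ m a ^ x`. -/
def bsMul (p q : ℕ × ℤ) : ℕ × ℤ := (p.1 + q.1, 2 ^ q.1 * p.2 + q.2)

/-- The product set in the coordinates `(m, x) ↦ b ^ m a ^ x`. -/
def bsProd (S T : Finset (ℕ × ℤ)) : Finset (ℕ × ℤ) := Finset.image₂ bsMul S T

/-- Commutation in the coordinates `(m, x) ↦ b ^ m a ^ x`. -/
def BsComm (p q : ℕ × ℤ) : Prop := bsMul p q = bsMul q p

instance BsComm.instDecidable (p q : ℕ × ℤ) : Decidable (BsComm p q) :=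
  inferInstanceAs (Decidable (bsMul p q = bsMul q p))

theorem bsMul_fst (p q : ℕ × ℤ) : (bsMul p q).1 = p.1 + q.1 := rfl

theorem bsMul_snd (p q : ℕ × ℤ) : (bsMul p q).2 = 2 ^ q.1 * p.2 + q.2 := rfl

theorem mem_bsProd {S T : Finset (ℕ × ℤ)} {r : ℕ × ℤ} :
    r ∈ bsProd S T ↔ ∃ p ∈ S, ∃ q ∈ T, bsMul p q = r :=
  Finset.mem_image₂

theorem bsMul_mem_bsProd {S T : Finset (ℕ × ℤ)} {p q : ℕ × ℤ} (hp : p ∈ S) (hq : q ∈ T) :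
    bsMul p q ∈ bsProd S T :=
  Finset.mem_image₂_of_mem hp hq

theorem bsProd_subset {S S' T T' : Finset (ℕ × ℤ)} (hS : S ⊆ S') (hT : T ⊆ T') :
    bsProd S T ⊆ bsProd S' T' :=
  Finset.image₂_subset hS hT

theorem bsMul_left_cancel {p q r : ℕ × ℤ} (h : bsMul p q = bsMul p r) : q = r := by
  have h1 := congrArg Prod.fst h
  have h2 := congrArg Prod.snd h
  rw [bsMul_fst, bsMul_fst] at h1
  rw [bsMul_snd, bsMul_snd] at h2
  have h3 : q.1 = r.1 := by omega
  rw [h3] at h2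
  exact Prod.ext h3 (by linarith)

theorem bsMul_right_cancel {p q r : ℕ × ℤ} (h : bsMul p r = bsMul q r) : p = q := by
  have h1 := congrArg Prod.fst h
  have h2 := congrArg Prod.snd h
  rw [bsMul_fst, bsMul_fst] at h1
  rw [bsMul_snd, bsMul_snd] at h2
  refine Prod.ext (by omega) (mul_left_cancel₀ (pow_ne_zero r.1 (two_ne_zero (α := ℤ))) ?_)
  linarith

theorem bsMul_self_injective {p q : ℕ × ℤ} (h : bsMul p p = bsMul q q) : p = q := by
  have h1 := congrArg Prod.fst h
  have h2 := congrArg Prod.snd h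
  rw [bsMul_fst, bsMul_fst] at h1
  rw [bsMul_snd, bsMul_snd] at h2
  have h3 : p.1 = q.1 := by omega
  rw [h3] at h2
  have h4 : (0 : ℤ) < 2 ^ q.1 + 1 := by positivity
  exact Prod.ext h3 (mul_left_cancel₀ h4.ne' (by linarith))

/-- With b^m a^x acting as y ↦ (y + x)/2^m, the fixed point for m > 0 is x/(2^m − 1). For two
positive levels the equation says that the fixed points agree. -/
theorem bsComm_iff {p q : ℕ × ℤ} :
    BsComm p q ↔ ((2 : ℤ) ^ q.1 - 1) * p.2 = (2 ^ p.1 - 1) * q.2 := by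
  unfold BsComm bsMul
  rw [Prod.mk.injEq]
  constructor
  · rintro ⟨-, h⟩
    linarith
  · intro h
    exact ⟨add_comm _ _, by linarith⟩

theorem BsComm.symm {p q : ℕ × ℤ} (h : BsComm p q) : BsComm q p := Eq.symm h

theorem two_pow_sub_one_pos {n : ℕ} (hn : 0 < n) : (0 : ℤ) < 2 ^ n - 1 := by
  have : (1 : ℤ) < 2 ^ n := one_lt_pow₀ (by norm_num) hn.ne'
  linarith

/-- Nontrivial commuting affine maps of this kind are either both translations or share their fixed
point. -/
theorem BsComm.trans {p q r : ℕ × ℤ} (hq : q ≠ (0, 0)) (h₁ : BsComm p q) (h₂ : BsComm q r) :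
    BsComm p r := by
  rw [bsComm_iff] at *
  rcases Nat.eq_zero_or_pos q.1 with h0 | hpos
  · have hq2 : q.2 ≠ 0 := fun h => hq (Prod.ext h0 h)
    simp only [h0, pow_zero, sub_self, zero_mul] at h₁ h₂
    have e1 := (mul_eq_zero.1 h₁.symm).resolve_right hq2
    have e2 := (mul_eq_zero.1 h₂).resolve_right hq2
    rw [e1, e2, zero_mul, zero_mul]
  · refine mul_left_cancel₀ (two_pow_sub_one_pos hpos).ne' ?_
    linear_combination (2 ^ r.1 - 1) * h₁ + (2 ^ p.1 - 1) * h₂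

theorem bsComm_bsMul_left {u p q : ℕ × ℤ} (h : BsComm u p) :
    BsComm u (bsMul p q) ↔ BsComm u q := by
  simp only [bsComm_iff, bsMul_fst, bsMul_snd, pow_add] at *
  constructor
  · intro h1
    linear_combination h1 - 2 ^ q.1 * h
  · intro h1
    linear_combination h1 + 2 ^ q.1 * h

theorem bsComm_bsMul_right {u p q : ℕ × ℤ} (h : BsComm u p) :
    BsComm u (bsMul q p) ↔ BsComm u q := by
  simp only [bsComm_iff, bsMul_fst, bsMul_snd, pow_add] at *
  constructor
  · intro h1
    refine mul_left_cancel₀ (pow_ne_zero p.1 (two_ne_zero (α := ℤ))) ?_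
    linear_combination h1 - h
  · intro h1
    linear_combination 2 ^ p.1 * h1 + h

theorem bsComm_bsMul_self {u p : ℕ × ℤ} : BsComm u (bsMul p p) ↔ BsComm u p := by
  simp only [bsComm_iff, bsMul_fst, bsMul_snd, pow_add]
  have h4 : (0 : ℤ) < 2 ^ p.1 + 1 := by positivity
  constructor
  · intro h1
    refine mul_left_cancel₀ h4.ne' ?_
    linear_combination h1
  · intro h1
    linear_combination (2 ^ p.1 + 1) * h1

theorem eq_of_bsComm_of_fst_eq {p q z : ℕ × ℤ} (hz : 0 < z.1) (hp : BsComm p z)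
    (hq : BsComm q z) (hpq : p.1 = q.1) : p = q := by
  rw [bsComm_iff] at hp hq
  rw [hpq] at hp
  exact Prod.ext hpq (mul_left_cancel₀ (two_pow_sub_one_pos hz).ne' (hp.trans hq.symm))

/-- The products p², q², pq, qp are distinct. This is needed for |S| = 2, where the several-level
bound yields only 3. -/
theorem four_le_card_bsProd {S : Finset (ℕ × ℤ)} {p q : ℕ × ℤ} (hp : p ∈ S) (hq : q ∈ S)
    (h : ¬ BsComm p q) : 4 ≤ (bsProd S S).card := by
  have hpq : p ≠ q := fun e => h (by rw [e]; rfl)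
  have hsub : ({bsMul p p, bsMul q q, bsMul p q, bsMul q p} : Finset (ℕ × ℤ)) ⊆ bsProd S S := by
    intro r hr
    simp only [Finset.mem_insert, Finset.mem_singleton] at hr
    rcases hr with rfl | rfl | rfl | rfl
    · exact bsMul_mem_bsProd hp hp
    · exact bsMul_mem_bsProd hq hq
    · exact bsMul_mem_bsProd hp hq
    · exact bsMul_mem_bsProd hq hp
  refine le_trans (le_of_eq ?_) (Finset.card_le_card hsub)
  rw [Finset.card_insert_of_notMem, Finset.card_insert_of_notMem, Finset.card_pair h]
  · simp only [Finset.mem_insert, Finset.mem_singleton, not_or]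
    exact ⟨fun e => hpq (bsMul_right_cancel e).symm, fun e => hpq (bsMul_left_cancel e).symm⟩
  · simp only [Finset.mem_insert, Finset.mem_singleton, not_or]
    exact ⟨fun e => hpq (bsMul_self_injective e), fun e => hpq (bsMul_left_cancel e),
      fun e => hpq (bsMul_right_cancel e)⟩

/-- The set of elements `b ^ m a ^ x`, `x ∈ A`, in coordinates. -/
def bsLevel (m : ℕ) (A : Finset ℤ) : Finset (ℕ × ℤ) := A.image fun x => (m, x)

theorem card_bsLevel (m : ℕ) (A : Finset ℤ) : (bsLevel m A).card = A.card :=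
  Finset.card_image_of_injective _ fun _ _ h => congrArg Prod.snd h

theorem exists_eq_bsLevel {S : Finset (ℕ × ℤ)} {m : ℕ} (h : ∀ p ∈ S, p.1 = m) :
    ∃ A : Finset ℤ, S = bsLevel m A := by
  refine ⟨S.image Prod.snd, ?_⟩
  unfold bsLevel
  rw [Finset.image_image]
  conv_lhs => rw [← Finset.image_id (s := S)]
  exact Finset.image_congr fun p hp => Prod.ext (h p hp) rfl

theorem bsProd_bsLevel (m n : ℕ) (A B : Finset ℤ) :
    bsProd (bsLevel m A) (bsLevel n B) = bsLevel (m + n) (A.image (fun x => 2 ^ n * x) + B) := by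
  ext r
  simp only [mem_bsProd, bsLevel, Finset.mem_image, Finset.mem_add]
  constructor
  · rintro ⟨_, ⟨x, hx, rfl⟩, _, ⟨y, hy, rfl⟩, rfl⟩
    exact ⟨_, ⟨_, ⟨x, hx, rfl⟩, y, hy, rfl⟩, rfl⟩
  · rintro ⟨_, ⟨_, ⟨x, hx, rfl⟩, y, hy, rfl⟩, rfl⟩
    exact ⟨_, ⟨x, hx, rfl⟩, _, ⟨y, hy, rfl⟩, rfl⟩

theorem bsLevel_nonempty {m : ℕ} {A : Finset ℤ} : (bsLevel m A).Nonempty ↔ A.Nonempty :=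
  Finset.image_nonempty

theorem card_add_card_le_card_bsProd {S T : Finset (ℕ × ℤ)} {m n : ℕ} (hS : ∀ p ∈ S, p.1 = m)
    (hT : ∀ p ∈ T, p.1 = n) (hSne : S.Nonempty) (hTne : T.Nonempty) :
    S.card + T.card ≤ (bsProd S T).card + 1 := by
  obtain ⟨A, rfl⟩ := exists_eq_bsLevel hS
  obtain ⟨B, rfl⟩ := exists_eq_bsLevel hT
  rw [bsLevel_nonempty] at hSne hTne
  rw [bsProd_bsLevel, card_bsLevel, card_bsLevel, card_bsLevel,
    ← card_image_mul (r := 2 ^ n) (by positivity) A]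
  exact card_add_card_le_card_add (hSne.image _) hTne

theorem three_mul_card_le_card_bsProd_self {S : Finset (ℕ × ℤ)} {m : ℕ} (hm : 0 < m)
    (hS : ∀ p ∈ S, p.1 = m) (hne : S.Nonempty) : 3 * S.card ≤ (bsProd S S).card + 2 := by
  obtain ⟨A, rfl⟩ := exists_eq_bsLevel hS
  rw [bsLevel_nonempty] at hne
  rw [bsProd_bsLevel, card_bsLevel, card_bsLevel]
  refine three_mul_card_le_card_dilate ?_ hne
  have := two_pow_sub_one_pos hm
  linarith

/-- The mixed products form (A ∪ 2^n·A) + B, so the parity bound for A + A and A ∪ 2^n·A applies. -/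
theorem card_level_zero_le {S T : Finset (ℕ × ℤ)} {n : ℕ} (hn : 0 < n) (hS : ∀ p ∈ S, p.1 = 0)
    (hT : ∀ p ∈ T, p.1 = n) (hSne : S.Nonempty) (hTne : T.Nonempty) :
    7 * S.card + 2 * T.card ≤
      2 * ((bsProd S S).card + (bsProd S T ∪ bsProd T S).card) + 5 := by
  obtain ⟨A, rfl⟩ := exists_eq_bsLevel hS
  obtain ⟨B, rfl⟩ := exists_eq_bsLevel hT
  rw [bsLevel_nonempty] at hSne hTne
  have h : bsProd (bsLevel 0 A) (bsLevel n B) ∪ bsProd (bsLevel n B) (bsLevel 0 A) =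
      bsLevel n ((A ∪ A.image fun x => 2 ^ n * x) + B) := by
    rw [bsProd_bsLevel, bsProd_bsLevel, add_zero, zero_add, Finset.union_add]
    unfold bsLevel
    rw [Finset.image_union, Finset.union_comm]
    simp only [pow_zero, one_mul, Finset.image_id', add_comm]
  rw [h, bsProd_bsLevel, card_bsLevel, card_bsLevel, card_bsLevel, card_bsLevel]
  have h1 := seven_mul_card_le_card_add_add_card_union hSne (r := 2 ^ n) (by positivity)
    (dvd_pow_self 2 hn.ne')
  have h2 := card_add_card_le_card_add
    (hSne.mono (Finset.subset_union_left (s₂ := A.image fun x => 2 ^ n * x))) hTne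
  simp only [pow_zero, one_mul, Finset.image_id']
  omega

/-- Translating a set within one level from the left and from the right by `z` gives the same set
only if `z` commutes with two (extremal) elements of it. -/
theorem card_lt_card_translates_or {Y : Finset (ℕ × ℤ)} {n : ℕ} {z : ℕ × ℤ} (hY : ∀ p ∈ Y, p.1 = n)
    (hne : Y.Nonempty) :
    Y.card + 1 ≤ (bsProd {z} Y ∪ bsProd Y {z}).card ∨
      ∃ p ∈ Y, ∃ q ∈ Y, BsComm z p ∧ BsComm z q ∧ (2 ≤ Y.card → p ≠ q) := by
  have c1 : (bsProd {z} Y).card = Y.card := by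
    unfold bsProd
    rw [Finset.image₂_singleton_left]
    exact Finset.card_image_of_injective _ fun _ _ h => bsMul_left_cancel h
  have c2 : (bsProd Y {z}).card = Y.card := by
    unfold bsProd
    rw [Finset.image₂_singleton_right]
    exact Finset.card_image_of_injective _ fun _ _ h => bsMul_right_cancel h
  by_cases hcard : Y.card + 1 ≤ (bsProd {z} Y ∪ bsProd Y {z}).card
  · exact Or.inl hcard
  right
  have e1 : bsProd {z} Y = bsProd {z} Y ∪ bsProd Y {z} :=
    Finset.eq_of_subset_of_card_le Finset.subset_union_left (by omega)
  have e2 : bsProd Y {z} = bsProd {z} Y ∪ bsProd Y {z} :=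
    Finset.eq_of_subset_of_card_le Finset.subset_union_right (by omega)
  have heq : bsProd {z} Y = bsProd Y {z} := e1.trans e2.symm
  have hl : ∀ y ∈ Y, ∃ w ∈ Y, bsMul z y = bsMul w z := by
    intro y hy
    have h1 := bsMul_mem_bsProd (Finset.mem_singleton_self z) hy
    rw [heq] at h1
    obtain ⟨w, hw, z', hz', h2⟩ := mem_bsProd.1 h1
    rw [Finset.mem_singleton.1 hz'] at h2
    exact ⟨w, hw, h2.symm⟩
  have hr : ∀ y ∈ Y, ∃ w ∈ Y, bsMul z w = bsMul y z := by
    intro y hy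
    have h1 := bsMul_mem_bsProd hy (Finset.mem_singleton_self z)
    rw [← heq] at h1
    obtain ⟨z', hz', w, hw, h2⟩ := mem_bsProd.1 h1
    rw [Finset.mem_singleton.1 hz'] at h2
    exact ⟨w, hw, h2⟩
  -- Solving zy = wz for w in terms of y is an increasing self-bijection of Y in the second
  -- coordinate, so it fixes the maximum and the minimum.
  have hpos : (0 : ℤ) < 2 ^ z.1 := by positivity
  obtain ⟨p, hp, hpmax⟩ := Finset.exists_max_image Y Prod.snd hne
  obtain ⟨q, hq, hqmin⟩ := Finset.exists_min_image Y Prod.snd hne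
  have key : ∀ y ∈ Y, ∀ w ∈ Y, bsMul z y = bsMul w z → 2 ^ n * z.2 + y.2 = 2 ^ z.1 * w.2 + z.2 := by
    intro y hy w _ h
    have := congrArg Prod.snd h
    rwa [bsMul_snd, bsMul_snd, hY y hy] at this
  have comm : ∀ y ∈ Y, 2 ^ n * z.2 + y.2 = 2 ^ z.1 * y.2 + z.2 → BsComm z y := by
    intro y hy h
    refine Prod.ext (add_comm _ _) ?_
    rw [bsMul_snd, bsMul_snd, hY y hy, h]
  refine ⟨p, hp, q, hq, comm p hp ?_, comm q hq ?_, ?_⟩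
  · obtain ⟨w, hw, h1⟩ := hl p hp
    obtain ⟨v, hv, h2⟩ := hr p hp
    have k1 := key p hp w hw h1
    have k2 := key v hv p hp h2
    have := mul_le_mul_of_nonneg_left (hpmax w hw) hpos.le
    have := hpmax v hv
    linarith
  · obtain ⟨w, hw, h1⟩ := hl q hq
    obtain ⟨v, hv, h2⟩ := hr q hq
    have k1 := key q hq w hw h1
    have k2 := key v hv q hq h2
    have := mul_le_mul_of_nonneg_left (hqmin w hw) hpos.le
    have := hqmin v hv
    linarith
  · rintro h2 rfl
    obtain ⟨r, hr, hrp⟩ := Finset.exists_mem_ne (show 1 < Y.card by omega) p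
    exact hrp (Prod.ext ((hY r hr).trans (hY p hp).symm)
      (le_antisymm (hpmax r hr) (hqmin r hr)))

theorem card_lt_card_translates_of_pos {Y : Finset (ℕ × ℤ)} {n : ℕ} {z : ℕ × ℤ}
    (hY : ∀ p ∈ Y, p.1 = n) (hcard : 2 ≤ Y.card) (hz : 0 < z.1) :
    Y.card + 1 ≤ (bsProd {z} Y ∪ bsProd Y {z}).card := by
  rcases card_lt_card_translates_or (z := z) hY (Finset.card_pos.1 (by omega)) with h |
    ⟨p, hp, q, hq, hzp, hzq, hpq⟩
  · exact h
  · exact absurd (eq_of_bsComm_of_fst_eq hz hzp.symm hzq.symm ((hY p hp).trans (hY q hq).symm))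
      (hpq hcard)

theorem card_lt_card_translates_of_not_comm {Y : Finset (ℕ × ℤ)} {n : ℕ} {z : ℕ × ℤ}
    (hY : ∀ p ∈ Y, p.1 = n) (hne : Y.Nonempty) (hz : ∀ p ∈ Y, ¬ BsComm z p) :
    Y.card + 1 ≤ (bsProd {z} Y ∪ bsProd Y {z}).card := by
  rcases card_lt_card_translates_or (z := z) hY hne with h | ⟨p, hp, -, -, hzp, -⟩
  · exact h
  · exact absurd hzp (hz p hp)

end Model

/-! ### Sets meeting several levels -/

section Levels

theorem bsProd_union_fst {S T : Finset (ℕ × ℤ)} {m n : ℕ} (hS : ∀ p ∈ S, p.1 = m)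
    (hT : ∀ p ∈ T, p.1 = n) : ∀ r ∈ bsProd S T ∪ bsProd T S, r.1 = m + n := by
  intro r hr
  rcases Finset.mem_union.1 hr with h | h
  · obtain ⟨p, hp, q, hq, rfl⟩ := mem_bsProd.1 h
    rw [bsMul_fst, hS p hp, hT q hq]
  · obtain ⟨p, hp, q, hq, rfl⟩ := mem_bsProd.1 h
    rw [bsMul_fst, hT p hp, hS q hq, add_comm]

theorem bsProd_self_fst {S : Finset (ℕ × ℤ)} {m : ℕ} (hS : ∀ p ∈ S, p.1 = m) :
    ∀ r ∈ bsProd S S, r.1 = m + m := by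
  intro r hr
  obtain ⟨p, hp, q, hq, rfl⟩ := mem_bsProd.1 hr
  rw [bsMul_fst, hS p hp, hS q hq]

/-- Splitting off the top level `T`, lying above `S`, with `U` the top level of `S`. -/
theorem card_bsProd_split_le {S T U : Finset (ℕ × ℤ)} {m n : ℕ} (hmn : m < n)
    (hS : ∀ p ∈ S, p.1 ≤ m) (hT : ∀ p ∈ T, p.1 = n) (hUS : U ⊆ S) (hU : ∀ p ∈ U, p.1 = m) :
    (bsProd S S).card + (bsProd U T ∪ bsProd T U).card + (bsProd T T).card ≤
      (bsProd (S ∪ T) (S ∪ T)).card := by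
  have hS2 : ∀ r ∈ bsProd S S, r.1 ≤ m + m := by
    intro r hr
    obtain ⟨p, hp, q, hq, rfl⟩ := mem_bsProd.1 hr
    exact add_le_add (hS p hp) (hS q hq)
  have hUT := bsProd_union_fst hU hT
  have hT2 := bsProd_self_fst hT
  have d1 : Disjoint (bsProd S S) (bsProd U T ∪ bsProd T U) := by
    rw [Finset.disjoint_left]
    intro r h1 h2
    have := hS2 r h1
    have := hUT r h2
    omega
  have d2 : Disjoint (bsProd S S ∪ (bsProd U T ∪ bsProd T U)) (bsProd T T) := by
    rw [Finset.disjoint_left]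
    intro r h1 h2
    have := hT2 r h2
    rcases Finset.mem_union.1 h1 with h1 | h1
    · have := hS2 r h1
      omega
    · have := hUT r h1
      omega
  rw [← Finset.card_union_of_disjoint d1, ← Finset.card_union_of_disjoint d2]
  refine Finset.card_le_card ?_
  have hl : S ⊆ S ∪ T := Finset.subset_union_left
  have hr : T ⊆ S ∪ T := Finset.subset_union_right
  exact Finset.union_subset (Finset.union_subset (bsProd_subset hl hl)
    (Finset.union_subset (bsProd_subset (hUS.trans hl) hr) (bsProd_subset hr (hUS.trans hl))))
    (bsProd_subset hr hr)

theorem two_levels_bound {S T : Finset (ℕ × ℤ)} {m n : ℕ} (hmn : m < n) (hS : ∀ p ∈ S, p.1 = m)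
    (hT : ∀ p ∈ T, p.1 = n) (hSne : S.Nonempty) (hTne : T.Nonempty) :
    7 * (S.card + T.card) ≤ 2 * (bsProd (S ∪ T) (S ∪ T)).card + 8 := by
  have h := card_bsProd_split_le hmn (fun p hp => (hS p hp).le) hT subset_rfl hS
  have h1 : 1 ≤ S.card := Finset.card_pos.2 hSne
  have h2 : 1 ≤ T.card := Finset.card_pos.2 hTne
  have hT2 := three_mul_card_le_card_bsProd_self (by omega) hT hTne
  rcases Nat.eq_zero_or_pos m with rfl | hm
  · have := card_level_zero_le hmn hS hT hSne hTne
    omega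
  · have hS2 := three_mul_card_le_card_bsProd_self hm hS hSne
    have h3 := card_add_card_le_card_bsProd hS hT hSne hTne
    have h4 := Finset.card_le_card
      (Finset.subset_union_left (s₁ := bsProd S T) (s₂ := bsProd T S))
    omega

/-- The bound for a set `S` of elements commuting with `w`, together with a higher level `T` not all
of whose elements commute with `w`. -/
theorem bound_of_comm {S T : Finset (ℕ × ℤ)} {m n : ℕ} {w : ℕ × ℤ} (hmn : m < n)
    (hS : ∀ p ∈ S, p.1 ≤ m) (hT : ∀ p ∈ T, p.1 = n) (hw : 0 < w.1) (hSw : ∀ p ∈ S, BsComm w p)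
    (hTw : ∃ p ∈ T, ¬ BsComm w p) (hcard : 2 ≤ S.card) :
    7 * (S.card + T.card) ≤ 2 * (bsProd (S ∪ T) (S ∪ T)).card + 8 := by
  have hw0 : w ≠ (0, 0) := by
    rintro rfl
    exact lt_irrefl _ hw
  set Y := T.filter fun p => ¬ BsComm w p with hY
  have hYne : Y.Nonempty := by
    obtain ⟨p, hp, h⟩ := hTw
    exact ⟨p, Finset.mem_filter.2 ⟨hp, h⟩⟩
  have hYT : Y ⊆ T := Finset.filter_subset _ _
  have hYn : ∀ p ∈ Y, p.1 = n := fun p hp => hT p (hYT hp)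
  have hSne : S.Nonempty := Finset.card_pos.1 (by omega)
  have hTne : T.Nonempty := hYne.mono hYT
  have hTY : T.card ≤ Y.card + 1 := by
    have h1 : (T.filter fun p => BsComm w p).card ≤ 1 := by
      refine Finset.card_le_one.2 fun p hp q hq => ?_
      rw [Finset.mem_filter] at hp hq
      exact eq_of_bsComm_of_fst_eq hw hp.2.symm hq.2.symm ((hT p hp.1).trans (hT q hq.1).symm)
    have h2 : (T.filter fun p => BsComm w p).card + Y.card = T.card :=
      Finset.card_filter_add_card_filter_not _
    omega
  have hYT' : Y.card ≤ T.card := Finset.card_le_card hYT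
  -- the levels of `S` are distinct
  have hinj : Set.InjOn Prod.fst (S : Set (ℕ × ℤ)) := fun p hp q hq h =>
    eq_of_bsComm_of_fst_eq hw (hSw p hp).symm (hSw q hq).symm h
  have hSS : 2 * S.card ≤ (bsProd S S).card + 1 := by
    have h1 := cauchy_davenport_add_of_linearOrder_isCancelAdd (hSne.image Prod.fst)
      (hSne.image Prod.fst)
    rw [Finset.card_image_of_injOn hinj] at h1
    have h2 : S.image Prod.fst + S.image Prod.fst ⊆ (bsProd S S).image Prod.fst := by
      intro x hx
      obtain ⟨_, hu, _, hv, rfl⟩ := Finset.mem_add.1 hx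
      obtain ⟨p, hp, rfl⟩ := Finset.mem_image.1 hu
      obtain ⟨q, hq, rfl⟩ := Finset.mem_image.1 hv
      exact Finset.mem_image.2 ⟨bsMul p q, bsMul_mem_bsProd hp hq, rfl⟩
    have h3 := (Finset.card_le_card h2).trans Finset.card_image_le
    omega
  have hTT := three_mul_card_le_card_bsProd_self (by omega) hT hTne
  -- the mixed products
  let X : ℕ × ℤ → Finset (ℕ × ℤ) := fun z => bsProd {z} Y ∪ bsProd Y {z}
  have hXfst : ∀ z, ∀ r ∈ X z, r.1 = z.1 + n := fun z => bsProd_union_fst (by simp) hYn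
  -- The identity commutes with everything and gains no extra product; the correction term pays for
  -- it, at most once.
  have hXcard : ∀ z ∈ S, Y.card + 1 ≤ (X z).card + if z = (0, 0) then 1 else 0 := by
    intro z hz
    split_ifs with hz0
    · have h1 := card_add_card_le_card_bsProd (S := {z}) (m := z.1) (by simp) hYn
        (Finset.singleton_nonempty z) hYne
      have h2 := Finset.card_le_card
        (Finset.subset_union_left (s₁ := bsProd {z} Y) (s₂ := bsProd Y {z}))
      rw [Finset.card_singleton] at h1
      change _ ≤ (bsProd {z} Y ∪ bsProd Y {z}).card + 1
      omega
    · refine card_lt_card_translates_of_not_comm hYn hYne fun p hp h => ?_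
      exact (Finset.mem_filter.1 hp).2 ((hSw z hz).trans hz0 h)
  have hsum : S.card * (Y.card + 1) ≤ (S.biUnion X).card + 1 := by
    rw [Finset.card_biUnion]
    · have h1 := Finset.sum_le_sum hXcard
      rw [Finset.sum_const, smul_eq_mul, Finset.sum_add_distrib, Finset.sum_ite_eq'] at h1
      split_ifs at h1 <;> omega
    · intro z hz z' hz' hne
      change Disjoint (X z) (X z')
      rw [Finset.disjoint_left]
      intro r h1 h2
      have e1 := hXfst z r h1
      have e2 := hXfst z' r h2
      exact hne (hinj hz hz' (by omega))
  have hQ : ∀ r ∈ S.biUnion X, ¬ BsComm w r ∧ r.1 ≤ m + n := by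
    intro r hr
    obtain ⟨z, hz, hr⟩ := Finset.mem_biUnion.1 hr
    refine ⟨fun h => ?_, by rw [hXfst z r hr]; exact Nat.add_le_add_right (hS z hz) n⟩
    rcases Finset.mem_union.1 hr with hr | hr
    · obtain ⟨p, hp, q, hq, rfl⟩ := mem_bsProd.1 hr
      rw [Finset.mem_singleton.1 hp, bsComm_bsMul_left (hSw z hz)] at h
      exact (Finset.mem_filter.1 hq).2 h
    · obtain ⟨p, hp, q, hq, rfl⟩ := mem_bsProd.1 hr
      rw [Finset.mem_singleton.1 hq, bsComm_bsMul_right (hSw z hz)] at h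
      exact (Finset.mem_filter.1 hp).2 h
  have d1 : Disjoint (bsProd S S) (S.biUnion X) := by
    rw [Finset.disjoint_left]
    intro r h1 h2
    obtain ⟨p, hp, q, hq, rfl⟩ := mem_bsProd.1 h1
    exact (hQ _ h2).1 ((bsComm_bsMul_left (hSw p hp)).2 (hSw q hq))
  have d2 : Disjoint (bsProd S S ∪ S.biUnion X) (bsProd T T) := by
    rw [Finset.disjoint_left]
    intro r h1 h2
    have h3 := bsProd_self_fst hT r h2
    rcases Finset.mem_union.1 h1 with h1 | h1
    · obtain ⟨p, hp, q, hq, rfl⟩ := mem_bsProd.1 h1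
      rw [bsMul_fst] at h3
      have := hS p hp
      have := hS q hq
      omega
    · have := (hQ r h1).2
      omega
  have hsub : (bsProd S S ∪ S.biUnion X) ∪ bsProd T T ⊆ bsProd (S ∪ T) (S ∪ T) := by
    have hl : S ⊆ S ∪ T := Finset.subset_union_left
    have hr : T ⊆ S ∪ T := Finset.subset_union_right
    refine Finset.union_subset (Finset.union_subset (bsProd_subset hl hl) ?_)
      (bsProd_subset hr hr)
    refine Finset.biUnion_subset.2 fun z hz => ?_
    have hz' : {z} ⊆ S ∪ T := Finset.singleton_subset_iff.2 (hl hz)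
    exact Finset.union_subset (bsProd_subset hz' (hYT.trans hr))
      (bsProd_subset (hYT.trans hr) hz')
  have htot := Finset.card_le_card hsub
  rw [Finset.card_union_of_disjoint d2, Finset.card_union_of_disjoint d1] at htot
  have hY1 : 1 ≤ Y.card := Finset.card_pos.2 hYne
  -- The collected bounds reduce the claim to |S| + |T| ≤ 2|S||Y|, and |T| ≤ |Y| + 1.
  have hkey : S.card + Y.card + 1 ≤ 2 * (S.card * Y.card) := by nlinarith
  rw [mul_add] at hsum
  omega

/-- Adding one element `y` on top of a non-commutative set whose highest level consists of a single
element `x` gives at least four new products. -/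
theorem four_new_products {S : Finset (ℕ × ℤ)} {x y : ℕ × ℤ} (hxS : x ∈ S) (hx : 0 < x.1)
    (hxy : x.1 < y.1) (hS : ∀ p ∈ S, p ≠ x → p.1 < x.1) (hne : ∃ p ∈ S, p ≠ x)
    (hna : ∃ p ∈ S, ∃ q ∈ S, ¬ BsComm p q) :
    (bsProd S S).card + 4 ≤ (bsProd (S ∪ {y}) (S ∪ {y})).card := by
  have hx0 : x ≠ (0, 0) := by
    rintro rfl
    exact lt_irrefl _ hx
  have hy0 : y ≠ (0, 0) := by
    rintro rfl
    exact absurd hxy (by simp)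
  have hle : ∀ p ∈ S, p.1 ≤ x.1 := by
    intro p hp
    by_cases h : p = x
    · rw [h]
    · exact (hS p hp h).le
  have hSS : ∀ r ∈ bsProd S S, r.1 ≤ x.1 + x.1 := by
    intro r hr
    obtain ⟨p, hp, q, hq, rfl⟩ := mem_bsProd.1 hr
    exact add_le_add (hle p hp) (hle q hq)
  have hl : S ⊆ S ∪ {y} := Finset.subset_union_left
  have hyS : y ∈ S ∪ {y} := Finset.mem_union_right _ (Finset.mem_singleton_self y)
  have finish : ∀ E : Finset (ℕ × ℤ), E.card = 4 → E ⊆ bsProd (S ∪ {y}) (S ∪ {y}) →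
      (∀ r ∈ E, r ∉ bsProd S S) →
      (bsProd S S).card + 4 ≤ (bsProd (S ∪ {y}) (S ∪ {y})).card := by
    intro E hE hsub hdisj
    rw [← hE, ← Finset.card_union_of_disjoint (Finset.disjoint_right.2 hdisj)]
    exact Finset.card_le_card (Finset.union_subset (bsProd_subset hl hl) hsub)
  have card4 : ∀ a b c d : ℕ × ℤ, a.1 < c.1 → a ≠ b → b.1 < c.1 → c.1 < d.1 →
      ({a, b, c, d} : Finset (ℕ × ℤ)).card = 4 := by
    intro a b c d hac hab hbc hcd
    rw [Finset.card_insert_of_notMem, Finset.card_insert_of_notMem, Finset.card_pair]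
    · rintro rfl
      omega
    · simp only [Finset.mem_insert, Finset.mem_singleton, not_or]
      constructor
      · rintro rfl
        omega
      · rintro rfl
        omega
    · simp only [Finset.mem_insert, Finset.mem_singleton, not_or]
      refine ⟨hab, ?_, ?_⟩
      · rintro rfl
        omega
      · rintro rfl
        omega
  by_cases hcomm : BsComm x y
  · -- the highest element `z` not commuting with `x`
    have hex : (S.filter fun p => bsMul x p ≠ bsMul p x).Nonempty := by
      by_contra hcon
      rw [Finset.not_nonempty_iff_eq_empty, Finset.filter_eq_empty_iff] at hcon
      obtain ⟨p, hp, q, hq, hpq⟩ := hna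
      have h1 : BsComm x p := not_not.1 (hcon hp)
      have h2 : BsComm x q := not_not.1 (hcon hq)
      exact hpq (h1.symm.trans hx0 h2)
    obtain ⟨z, hz, hzmax⟩ := Finset.exists_max_image _ Prod.fst hex
    rw [Finset.mem_filter] at hz
    have hxz : ¬ BsComm x z := hz.2
    have hmax : ∀ p ∈ S, ¬ BsComm x p → p.1 ≤ z.1 := fun p hp h =>
      hzmax p (Finset.mem_filter.2 ⟨hp, h⟩)
    have hzx : z.1 < x.1 := hS z hz.1 (by rintro rfl; exact hxz rfl)
    -- A product of elements of `S` not commuting with `x` has a factor not commuting with `x`, so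
    -- its level is at most x.1 + z.1 < y.1 + z.1.
    have hnew : ∀ r : ℕ × ℤ, r.1 = y.1 + z.1 → ¬ BsComm x r → r ∉ bsProd S S := by
      intro r hr hxr hmem
      obtain ⟨u, hu, v, hv, rfl⟩ := mem_bsProd.1 hmem
      rw [bsMul_fst] at hr
      by_cases hxu : BsComm x u
      · have hxv : ¬ BsComm x v := fun h => hxr ((bsComm_bsMul_left hxu).2 h)
        have := hmax v hv hxv
        have := hle u hu
        omega
      · have := hmax u hu hxu
        have := hle v hv
        omega
    have hyz : ¬ BsComm y z := fun h => hxz (hcomm.trans hy0 h)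
    refine finish {bsMul y z, bsMul z y, bsMul x y, bsMul y y} ?_ ?_ ?_
    · refine card4 _ _ _ _ ?_ hyz ?_ ?_ <;> simp only [bsMul_fst] <;> omega
    · intro r hr
      simp only [Finset.mem_insert, Finset.mem_singleton] at hr
      rcases hr with rfl | rfl | rfl | rfl
      · exact bsMul_mem_bsProd hyS (hl hz.1)
      · exact bsMul_mem_bsProd (hl hz.1) hyS
      · exact bsMul_mem_bsProd (hl hxS) hyS
      · exact bsMul_mem_bsProd hyS hyS
    · intro r hr
      simp only [Finset.mem_insert, Finset.mem_singleton] at hr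
      rcases hr with rfl | rfl | rfl | rfl
      · exact hnew _ rfl fun h => hxz ((bsComm_bsMul_left hcomm).1 h)
      · exact hnew _ (add_comm _ _) fun h => hxz ((bsComm_bsMul_right hcomm).1 h)
      · intro h
        have := hSS _ h
        rw [bsMul_fst] at this
        omega
      · intro h
        have := hSS _ h
        rw [bsMul_fst] at this
        omega
  · -- the highest element `z` below `x`
    have hex : (S.erase x).Nonempty := by
      obtain ⟨p, hp, h⟩ := hne
      exact ⟨p, Finset.mem_erase.2 ⟨h, hp⟩⟩
    obtain ⟨z, hz, hzmax⟩ := Finset.exists_max_image _ Prod.fst hex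
    rw [Finset.mem_erase] at hz
    have hzx := hS z hz.2 hz.1
    have hnew : ∀ r ∈ bsProd S S, r.1 = y.1 + z.1 → r = bsMul x x := by
      intro r hr hr1
      obtain ⟨u, hu, v, hv, rfl⟩ := mem_bsProd.1 hr
      rw [bsMul_fst] at hr1
      have h1 := hle u hu
      have h2 := hle v hv
      have hux : u = x := by
        by_contra hux
        have := hzmax u (Finset.mem_erase.2 ⟨hux, hu⟩)
        omega
      have hvx : v = x := by
        by_contra hvx
        have := hzmax v (Finset.mem_erase.2 ⟨hvx, hv⟩)
        omega
      rw [hux, hvx]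
    obtain ⟨e, he, he1, heS⟩ : ∃ e ∈ bsProd (S ∪ {y}) (S ∪ {y}), e.1 = y.1 + z.1 ∧
        e ∉ bsProd S S := by
      -- If yz and zy were both old, both would equal x². Then y would commute with z, hence with yz
      -- = x², hence with x.
      by_contra! hcon
      have h1 := hnew _ (hcon (bsMul y z) (bsMul_mem_bsProd hyS (hl hz.2)) rfl) rfl
      have h2 := hnew _ (hcon (bsMul z y) (bsMul_mem_bsProd (hl hz.2) hyS) (add_comm _ _))
        (add_comm _ _)
      have h3 : BsComm y z := h1.trans h2.symm
      have h4 : BsComm y (bsMul y z) := (bsComm_bsMul_left (p := y) rfl).2 h3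
      rw [h1, bsComm_bsMul_self] at h4
      exact hcomm h4.symm
    have hcard : ({e, bsMul x y, bsMul y x, bsMul y y} : Finset (ℕ × ℤ)).card = 4 := by
      have h1 : (bsMul x y).1 = x.1 + y.1 := rfl
      have h2 : (bsMul y x).1 = y.1 + x.1 := rfl
      have h3 : (bsMul y y).1 = y.1 + y.1 := rfl
      rw [Finset.card_insert_of_notMem, Finset.card_insert_of_notMem, Finset.card_pair]
      · intro h
        have := congrArg Prod.fst h
        omega
      · simp only [Finset.mem_insert, Finset.mem_singleton, not_or]
        refine ⟨hcomm, fun h => ?_⟩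
        have := congrArg Prod.fst h
        omega
      · simp only [Finset.mem_insert, Finset.mem_singleton, not_or]
        refine ⟨fun h => ?_, fun h => ?_, fun h => ?_⟩ <;>
        · have := congrArg Prod.fst h
          omega
    refine finish _ hcard ?_ ?_
    · intro r hr
      simp only [Finset.mem_insert, Finset.mem_singleton] at hr
      rcases hr with rfl | rfl | rfl | rfl
      · exact he
      · exact bsMul_mem_bsProd (hl hxS) hyS
      · exact bsMul_mem_bsProd hyS (hl hxS)
      · exact bsMul_mem_bsProd hyS hyS
    · intro r hr
      simp only [Finset.mem_insert, Finset.mem_singleton] at hr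
      rcases hr with rfl | rfl | rfl | rfl
      · exact heS
      all_goals
        intro h
        have := hSS _ h
        rw [bsMul_fst] at this
        omega

/-- A non-commutative set meeting at least two levels has large product set. -/
theorem several_levels_bound {S : Finset (ℕ × ℤ)} (hna : ∃ p ∈ S, ∃ q ∈ S, ¬ BsComm p q)
    (hlev : ∃ p ∈ S, ∃ q ∈ S, p.1 ≠ q.1) : 7 * S.card ≤ 2 * (bsProd S S).card + 8 := by
  induction hN : S.card using Nat.strong_induction_on generalizing S with
  | _ N ih =>
    subst hN
    have hSne : S.Nonempty := by
      obtain ⟨p, hp, -⟩ := hlev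
      exact ⟨p, hp⟩
    obtain ⟨y, hyS, hymax⟩ := Finset.exists_max_image S Prod.fst hSne
    set T := S.filter fun p => p.1 = y.1 with hT
    set S' := S.filter fun p => ¬ p.1 = y.1 with hS'
    have hTne : T.Nonempty := ⟨y, Finset.mem_filter.2 ⟨hyS, rfl⟩⟩
    have hTy : ∀ p ∈ T, p.1 = y.1 := fun p hp => (Finset.mem_filter.1 hp).2
    have hunion : S' ∪ T = S := by
      rw [Finset.union_comm]
      exact Finset.filter_union_filter_not_eq _ S
    have hcard : T.card + S'.card = S.card := Finset.card_filter_add_card_filter_not _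
    have hS'ne : S'.Nonempty := by
      obtain ⟨p, hp, q, hq, hpq⟩ := hlev
      by_cases h : p.1 = y.1
      · exact ⟨q, Finset.mem_filter.2 ⟨hq, by omega⟩⟩
      · exact ⟨p, Finset.mem_filter.2 ⟨hp, h⟩⟩
    have hS'y : ∀ p ∈ S', p.1 < y.1 := fun p hp =>
      lt_of_le_of_ne (hymax p (Finset.mem_filter.1 hp).1) (Finset.mem_filter.1 hp).2
    obtain ⟨x, hxS', hxmax⟩ := Finset.exists_max_image S' Prod.fst hS'ne
    have hxy := hS'y x hxS'
    by_cases hone : ∀ p ∈ S', p.1 = x.1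
    · have h := two_levels_bound hxy hone hTy hS'ne hTne
      rw [hunion] at h
      omega
    push Not at hone
    obtain ⟨v, hvS', hvx⟩ := hone
    have hvlt : v.1 < x.1 := lt_of_le_of_ne (hxmax v hvS') hvx
    have hx : 0 < x.1 := by omega
    have hx0 : x ≠ (0, 0) := by
      rintro rfl
      exact lt_irrefl _ hx
    by_cases hna' : ∃ p ∈ S', ∃ q ∈ S', ¬ BsComm p q
    · have hT1 : 1 ≤ T.card := Finset.card_pos.2 hTne
      have hIH := ih S'.card (by omega) hna' ⟨v, hvS', x, hxS', hvx⟩ rfl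
      set U := S'.filter fun p => p.1 = x.1 with hU
      have hUx : ∀ p ∈ U, p.1 = x.1 := fun p hp => (Finset.mem_filter.1 hp).2
      have hxU : x ∈ U := Finset.mem_filter.2 ⟨hxS', rfl⟩
      have hU1 : 1 ≤ U.card := Finset.card_pos.2 ⟨x, hxU⟩
      have hsplit := card_bsProd_split_le (U := U) hxy hxmax hTy (Finset.filter_subset _ _) hUx
      rw [hunion] at hsplit
      have hTT := three_mul_card_le_card_bsProd_self (by omega) hTy hTne
      have hUT := card_add_card_le_card_bsProd hUx hTy ⟨x, hxU⟩ hTne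
      have hUT' := Finset.card_le_card
        (Finset.subset_union_left (s₁ := bsProd U T) (s₂ := bsProd T U))
      -- Removing `T` must account for 3.5|T| products. The bounds |U| + |T| − 1 for mixed products
      -- and 3|T| − 2 for T² suffice when |U|, |T| ≥ 2. If exactly one of them is 1, two-sided
      -- translation gains one more mixed product; if both are 1, `four_new_products` is used.
      rcases hU1.eq_or_lt with hU1 | hU2
      · obtain ⟨x', hx'⟩ := Finset.card_eq_one.1 hU1.symm
        have hxx' : x = x' := Finset.mem_singleton.1 (hx' ▸ hxU)
        subst hxx'
        rcases hT1.eq_or_lt with hT1 | hT2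
        · obtain ⟨y', hy'⟩ := Finset.card_eq_one.1 hT1.symm
          have hyy' : y = y' := Finset.mem_singleton.1
            (hy' ▸ Finset.mem_filter.2 ⟨hyS, rfl⟩ : y ∈ ({y'} : Finset (ℕ × ℤ)))
          subst hyy'
          have h4 := four_new_products hxS' hx hxy (fun p hp hpx => ?_) ⟨v, hvS', fun h => ?_⟩ hna'
          · rw [← hy', hunion] at h4
            omega
          · refine lt_of_le_of_ne (hxmax p hp) fun h => hpx ?_
            exact Finset.mem_singleton.1 (hx' ▸ Finset.mem_filter.2 ⟨hp, h⟩)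
          · exact hvx (by rw [h])
        · have h := card_lt_card_translates_of_pos (z := x) hTy hT2 hx
          rw [hx'] at hsplit
          omega
      · rcases hT1.eq_or_lt with hT1 | hT2
        · obtain ⟨y', hy'⟩ := Finset.card_eq_one.1 hT1.symm
          have hy'1 : y'.1 = y.1 := hTy y' (by rw [hy']; exact Finset.mem_singleton_self _)
          have h := card_lt_card_translates_of_pos (z := y') hUx hU2 (by omega)
          rw [hy', Finset.union_comm] at hsplit
          rw [hy', Finset.card_singleton] at hTT
          omega
        · omega
    · push Not at hna'
      have hSw : ∀ p ∈ S', BsComm x p := fun p hp => hna' x hxS' p hp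
      have hTw : ∃ p ∈ T, ¬ BsComm x p := by
        by_contra! hcon
        have hall : ∀ p ∈ S, BsComm x p := by
          intro p hp
          rw [← hunion] at hp
          exact (Finset.mem_union.1 hp).elim (hSw p) (hcon p)
        obtain ⟨p, hp, q, hq, hpq⟩ := hna
        exact hpq ((hall p hp).symm.trans hx0 (hall q hq))
      have hc2 : 2 ≤ S'.card := Finset.one_lt_card.2 ⟨v, hvS', x, hxS', fun h => hvx (by rw [h])⟩
      have h := bound_of_comm hxy hxmax hTy hx hSw hTw hc2
      rw [hunion] at h
      omega

end Levels

/-! ### Faithfulness of the coordinates -/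

namespace BaumslagSolitar

/-- The element `b ^ m a ^ x` with coordinates `(m, x)`. -/
def ofCoords (p : ℕ × ℤ) : BaumslagSolitar 1 2 := b 1 2 ^ p.1 * a 1 2 ^ p.2

theorem ofCoords_mul (p q : ℕ × ℤ) : ofCoords p * ofCoords q = ofCoords (bsMul p q) := by
  unfold ofCoords
  rw [bsMul_fst, bsMul_snd, pow_add, zpow_add, mul_assoc, ← mul_assoc (a 1 2 ^ p.2),
    a_zpow_mul_b_pow]
  simp only [mul_assoc]

/-- The images of the generators `a`, `b` under the affine action on `ℚ`. -/
def affineGen : Fin 2 → Equiv.Perm ℚ :=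
  ![Equiv.addRight 1, Equiv.mulRight₀ (1 / 2) (by norm_num)]

theorem affineGen_rels : ∀ r ∈ baumslagSolitarRels 1 2, FreeGroup.lift affineGen r = 1 := by
  intro r hr
  rw [baumslagSolitarRels, Set.mem_singleton_iff] at hr
  subst hr
  simp only [map_mul, map_inv, map_zpow, FreeGroup.lift_apply_of, affineGen, Matrix.cons_val_zero,
    Matrix.cons_val_one]
  rw [mul_inv_eq_one, mul_assoc, inv_mul_eq_iff_eq_mul]
  ext y
  simp
  ring

/-- The affine action of `BS(1, 2)` on `ℚ`: `a` is `y ↦ y + 1` and `b` is `y ↦ y / 2`. -/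
def toPerm : BaumslagSolitar 1 2 →* Equiv.Perm ℚ := PresentedGroup.toGroup affineGen_rels

theorem toPerm_a : toPerm (a 1 2) = Equiv.addRight 1 :=
  PresentedGroup.toGroup.of affineGen_rels

theorem toPerm_b : toPerm (b 1 2) = Equiv.mulRight₀ (1 / 2) (by norm_num) :=
  PresentedGroup.toGroup.of affineGen_rels

theorem toPerm_ofCoords (p : ℕ × ℤ) (y : ℚ) : toPerm (ofCoords p) y = (y + p.2) * (1 / 2) ^ p.1 := by
  have hb : ∀ (m : ℕ) (y : ℚ), (toPerm (b 1 2) ^ m) y = y * (1 / 2) ^ m := by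
    intro m
    induction m with
    | zero => simp
    | succ m ih =>
      intro y
      rw [pow_succ, Equiv.Perm.mul_apply, ih, toPerm_b, pow_succ]
      simp
      ring
  have ha : ∀ (n : ℤ) (y : ℚ), (Equiv.addRight (1 : ℚ) ^ n) y = y + n := by
    intro n
    induction n using Int.induction_on with
    | zero => simp
    | succ n ih =>
      intro y
      rw [zpow_add_one, Equiv.Perm.mul_apply, ih]
      push_cast
      simp
      ring
    | pred n ih =>
      intro y
      rw [zpow_sub_one, Equiv.Perm.mul_apply, ih]
      push_cast
      simp
      ring
  rw [ofCoords, map_mul, map_pow, map_zpow, Equiv.Perm.mul_apply, hb, toPerm_a, ha]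

/-- The images of 0 and 1 under the affine action differ by 2^(−m), which recovers m and then x. -/
theorem ofCoords_injective : Function.Injective ofCoords := by
  intro p q hpq
  have h0 : ((p.2 : ℚ)) * (1 / 2) ^ p.1 = q.2 * (1 / 2) ^ q.1 := by
    simpa [toPerm_ofCoords] using congrArg (fun g => toPerm g 0) hpq
  have h1 : (1 + (p.2 : ℚ)) * (1 / 2) ^ p.1 = (1 + q.2) * (1 / 2) ^ q.1 := by
    have := congrArg (fun g => toPerm g 1) hpq
    simpa only [toPerm_ofCoords] using this
  have h2 : (1 / 2 : ℚ) ^ p.1 = (1 / 2) ^ q.1 := by linarith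
  have h3 : p.1 = q.1 := pow_right_injective₀ (by norm_num) (by norm_num) h2
  rw [h3] at h0
  refine Prod.ext h3 ?_
  exact_mod_cast mul_right_cancel₀ (by positivity) h0

theorem ofCoords_image_mul (T : Finset (ℕ × ℤ)) :
    (ofCoords '' (T : Set (ℕ × ℤ))) * (ofCoords '' (T : Set (ℕ × ℤ))) =
      ofCoords '' (bsProd T T : Set (ℕ × ℤ)) := by
  ext g
  simp only [Set.mem_mul, Set.mem_image, Finset.mem_coe, mem_bsProd]
  constructor
  · rintro ⟨_, ⟨p, hp, rfl⟩, _, ⟨q, hq, rfl⟩, rfl⟩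
    exact ⟨_, ⟨p, hp, q, hq, rfl⟩, (ofCoords_mul p q).symm⟩
  · rintro ⟨_, ⟨p, hp, q, hq, rfl⟩, rfl⟩
    exact ⟨_, ⟨p, hp, rfl⟩, _, ⟨q, hq, rfl⟩, ofCoords_mul p q⟩

end BaumslagSolitar

/-! ### Assembly -/

/-- If the generators commuted pairwise, the closure would centralize `S`, and then also itself. -/
theorem IsNonabelianSubset.exists_not_commute {G : Type*} [Group G] {S : Set G}
    (h : IsNonabelianSubset S) : ∃ x ∈ S, ∃ y ∈ S, x * y ≠ y * x := by
  by_contra! hcon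
  refine h fun x hx y hy => ?_
  have h1 : Subgroup.closure S ≤ Subgroup.centralizer S := by
    rw [Subgroup.closure_le]
    intro x hx
    exact Subgroup.mem_centralizer_iff.2 fun y hy => hcon y hy x hx
  have h2 : Subgroup.closure S ≤ Subgroup.centralizer (Subgroup.closure S : Set G) := by
    rw [Subgroup.closure_le]
    intro x hx
    exact Subgroup.mem_centralizer_iff.2 fun y hy =>
      (Subgroup.mem_centralizer_iff.1 (h1 hy) x hx).symm
  exact (Subgroup.mem_centralizer_iff.1 (h2 hy) x hx)

/-- The theorem in coordinates. -/
theorem bsProd_self_structure {T : Finset (ℕ × ℤ)} (hna : ∃ p ∈ T, ∃ q ∈ T, ¬ BsComm p q) :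
    3 * T.card ≤ (bsProd T T).card + 2 ∧
    (2 * (bsProd T T).card + 8 < 7 * T.card → ∃ A : Finset ℤ, T = bsLevel 1 A ∧
      ∃ (u d : ℤ) (l : ℕ), 0 < d ∧ (∀ x ∈ A, ∃ i : ℕ, i ≤ l ∧ x = u + i * d) ∧
        l + 2 * T.card ≤ (bsProd T T).card + 1) := by
  obtain ⟨p, hp, q, hq, hpq⟩ := hna
  have h4 := four_le_card_bsProd hp hq hpq
  have h2 : 2 ≤ T.card := Finset.one_lt_card.2 ⟨p, hp, q, hq, fun h => hpq (by rw [h]; rfl)⟩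
  by_cases hlev : ∃ p ∈ T, ∃ q ∈ T, p.1 ≠ q.1
  · have h := several_levels_bound ⟨p, hp, q, hq, hpq⟩ hlev
    exact ⟨by omega, fun h' => by omega⟩
  push Not at hlev
  obtain ⟨A, hA⟩ := exists_eq_bsLevel fun r hr => hlev r hr p hp
  have hT : T.card = A.card := by rw [hA, card_bsLevel]
  have hTT : (bsProd T T).card = (A.image (fun x => 2 ^ p.1 * x) + A).card := by
    rw [hA, bsProd_bsLevel, card_bsLevel]
  rw [hTT] at h4 ⊢
  rw [hT]
  rw [hT] at h2
  have hp0 : p.1 ≠ 0 := by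
    intro h0
    have hq0 : q.1 = 0 := by rw [hlev q hq p hp, h0]
    rw [bsComm_iff, h0, hq0] at hpq
    simp at hpq
  rcases Nat.lt_or_ge p.1 2 with h1 | h1
  · have hp1 : p.1 = 1 := by omega
    rw [hp1, pow_one] at h4 ⊢
    obtain ⟨u, d, l, hd, -, hAP, hl, h⟩ := exists_progression_of_dilate le_rfl h2
    refine ⟨by omega, fun h' => ⟨A, by rw [← hp1]; exact hA, u, d, l, hd, hAP, by omega⟩⟩
  · have hr : (4 : ℤ) ≤ 2 ^ p.1 := by
      calc (4 : ℤ) = 2 ^ 2 := by norm_num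
        _ ≤ 2 ^ p.1 := pow_le_pow_right₀ (by norm_num) h1
    have h := four_mul_card_le_card_dilate hr h2
    exact ⟨by omega, fun h' => by omega⟩

theorem theorem6p1 (S : Set (BaumslagSolitar 1 2)) (hfin : S.Finite)
    (hplus : S ⊆ (BaumslagSolitar.plus : Set (BaumslagSolitar 1 2)))
    (hna : IsNonabelianSubset S) (k : ℕ) (hk : S.ncard = k) :
    3 * (k : ℤ) - 2 ≤ ((S * S).ncard : ℤ) ∧
    ∀ h : ℤ, ((S * S).ncard : ℤ) = (3 * (k : ℤ) - 2) + h →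
      ((S * S).ncard : ℝ) < 3.5 * (k : ℝ) - 4 →
      ∃ A : Finset ℤ,
        S = (fun x : ℤ => BaumslagSolitar.b 1 2 * BaumslagSolitar.a 1 2 ^ x) '' (A : Set ℤ) ∧
        ∃ P : Finset ℤ, IsFiniteArithProg P ∧ A ⊆ P ∧ (P.card : ℤ) = (k : ℤ) + h ∧
          (k : ℝ) + (h : ℝ) < 1.5 * (k : ℝ) - 2 := by
  obtain ⟨T, rfl⟩ : ∃ T : Finset (ℕ × ℤ),
      S = BaumslagSolitar.ofCoords '' (T : Set (ℕ × ℤ)) := by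
    refine ⟨(hfin.preimage BaumslagSolitar.ofCoords_injective.injOn).toFinset, ?_⟩
    rw [Set.Finite.coe_toFinset, Set.image_preimage_eq_of_subset]
    intro g hg
    obtain ⟨m, x, rfl⟩ := hplus hg
    exact ⟨(m, x), rfl⟩
  rw [Set.ncard_image_of_injective _ BaumslagSolitar.ofCoords_injective,
    Set.ncard_coe_finset] at hk
  rw [BaumslagSolitar.ofCoords_image_mul,
    Set.ncard_image_of_injective _ BaumslagSolitar.ofCoords_injective, Set.ncard_coe_finset]
  subst hk
  have hna' : ∃ p ∈ T, ∃ q ∈ T, ¬ BsComm p q := by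
    obtain ⟨_, ⟨p, hp, rfl⟩, _, ⟨q, hq, rfl⟩, h⟩ := hna.exists_not_commute
    refine ⟨p, hp, q, hq, fun hpq => h ?_⟩
    rw [BaumslagSolitar.ofCoords_mul, BaumslagSolitar.ofCoords_mul, hpq]
  obtain ⟨h3, hstruct⟩ := bsProd_self_structure hna'
  refine ⟨by omega, fun h hh hlt => ?_⟩
  have hlt' : 2 * (bsProd T T).card + 8 < 7 * T.card := by
    have : (2 * (bsProd T T).card + 8 : ℝ) < 7 * T.card := by linarith
    exact_mod_cast this
  obtain ⟨A, hA, u, d, l, hd, hAP, hl⟩ := hstruct hlt'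
  -- The inequality `hl` reads l + 1 ≤ k + h, so the progression with l + 1 terms is prolonged to
  -- exactly k + h.
  refine ⟨A, ?_, (Finset.range ((T.card : ℤ) + h).toNat).image fun i : ℕ => u + (i : ℤ) * d,
    ⟨u, d, _, hd, rfl⟩, ?_, ?_, ?_⟩
  · rw [hA, bsLevel, Finset.coe_image, Set.image_image]
    simp only [BaumslagSolitar.ofCoords, pow_one]
  · intro x hx
    obtain ⟨i, hi, rfl⟩ := hAP x hx
    exact Finset.mem_image.2 ⟨i, Finset.mem_range.2 (by omega), rfl⟩
  · rw [Finset.card_image_of_injective, Finset.card_range]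
    · omega
    · intro i j hij
      have h1 : (i : ℤ) * d = j * d := add_left_cancel hij
      exact_mod_cast mul_right_cancel₀ hd.ne' h1
  · have : ((bsProd T T).card : ℝ) = (3 * T.card - 2) + h := by exact_mod_cast hh
    linarith
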